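/- \textbf{Theorem (Christoffel numbers positivity).} Let $p,q\ge 1$ and let $T=(T_{i,j})_{i,j\ge 0}$ be a real semi-infinite banded matrix ($p$ subdiagonals, $q$ superdiagonals) with a positive bidiagonal factorization $$T=L_1\cdots L_p\,\Delta\,U_q\cdots U_1,$$ i.e. $\Delta=\operatorname{diag}(\Delta_0,\Delta_1,\dots)$, $L_k$ is lower bidiagonal with unit diagonal and subdiagonal $L_{k|0},L_{k|1},\dots$, $U_k$ is upper bidiagonal with unit diagonal and superdiagonal $U_{k|0},U_{k|1},\dots$, and all $L_{k|i},U_{k|i},\Delta_i$ are positive. Write $M^{[N]}$ for the leading principal submatrix of $M$ with indices $0,\dots,N$. \emph{Recursion polynomials.} For lower unitriangular $\nu\in\mathbb R^{p\times p}$ and $\xi\in\mathbb R^{q\times q}$ let $A^{(a)}=(A^{(a)}_n)_{n\ge0}$, $1\le a\le p$, and $B^{(b)}=(B^{(b)}_n)_{n\ge 0}$, $1\le b\le q$, be the sequences of polynomials in $x$ with $A^{(a)}T=xA^{(a)}$ (row vectors), $TB^{(b)}=xB^{(b)}$ (column vectors), such that $(A^{(a)}_0,\dots,A^{(a)}_{p-1})^\top$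 is the $a$-th column of $\nu$ and $(B^{(b)}_0,\dots,B^{(b)}_{q-1})^\top$ is the $b$-th column of $\xi$. \emph{Christoffel numbers.} Let $Q_{n,N}$ be the determinant with rows $(A^{(1)}_m,\dots,A^{(p)}_m)$, $m=n,N+1,\dots,N+p-1$, let $R_{n,N}$ be the determinant with rows $(B^{(1)}_m,\dots,B^{(q)}_m)$, $m=n,N+1,\dots,N+q-1$, and let $\beta_N=(-1)^{(q-1)N}T_{0,q}T_{1,q+1}\cdots T_{N-1,N+q-1}$ (so $\beta_0=1$). For an eigenvalue $\lambda_k^{[N]}$ of $T^{[N]}$ put $$\rho^{[N]}_{k,b}=(-1)^{b-1}\beta_N\det\big[B^{(c)}_{N+i}(\lambda^{[N]}_k)\big]_{1\le i\le q-1,\ c\neq b},\qquad \mu^{[N]}_{k,a}=\frac{(-1)^{a-1}\det\big[A^{(c)}_{N+i}(\lambda^{[N]}_k)\big]_{1\le i\le p-1,\ c\ne a}}{\beta_N\sum_{l=0}^N Q_{l,N}(\lambda^{[N]}_k)R_{l,N}(\lambda^{[N]}_k)}$$ (an empty determinant is $1$). \emph{The matrices $\Lambda$, $\Upsilon$.}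 Let $\Lambda\in\mathbb R^{p\times p}$ have first column $e_1$ and, for $2\le k\le p$, $k$-th column $\frac1{r_k}L_1^{[p-1]}\cdots L_{k-1}^{[p-1]}e_1$, where $r_k=L_{k-1|0}L_{k-2|1}\cdots L_{1|k-2}$. Let $\Upsilon\in\mathbb R^{q\times q}$ have first row $e_1^\top$ and, for $2\le k\le q$, $k$-th row $\frac1{s_k}e_1^\top U_{k-1}^{[q-1]}\cdots U_1^{[q-1]}$, where $s_k=U_{k-1|0}U_{k-2|1}\cdots U_{1|k-2}$. Suppose that $\nu^{-\top}=\Lambda\mathcal A$ and $\xi^{-1}=\mathcal B\,\Upsilon$ for some entrywise nonnegative matrices $\mathcal A\in\mathbb R^{p\times p}$, upper unitriangular, and $\mathcal B\in\mathbb R^{q\times q}$, lower unitriangular. Then for every $N\ge0$ the matrix $T^{[N]}$ has $N+1$ distinct real eigenvalues $\lambda^{[N]}_1>\dots>\lambda^{[N]}_{N+1}$, and $$\rho^{[N]}_{k,b}>0,\qquad \mu^{[N]}_{k,a}>0\qquad\text{for all } k\in\{1,\dots,N+1\},\ a\in\{1,\dots,p\},\ b\in\{1,\dots,q\}.$$ 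-/

import Mathlib

open Polynomial Matrix

noncomputable section

namespace MixedBanded

/-- Product of semi-infinite matrices. Below it is only applied to left factors with finitely many
nonzero entries in each row, so that all the sums are finite. -/
def infMul (M K : Matrix ℕ ℕ ℝ) : Matrix ℕ ℕ ℝ :=
  Matrix.of fun i j => ∑ᶠ k, M i k * K k j

/-- The product `M₁ (M₂ (⋯ (Mᵣ I)))` of a list of semi-infinite matrices. -/
def infProd (l : List (Matrix ℕ ℕ ℝ)) : Matrix ℕ ℕ ℝ :=
  l.foldr infMul 1

/-- The leading principal `n × n` submatrix; the truncation written `M^{[N]}` is `trunc (N + 1) M`,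
with rows and columns `0, …, N`. -/
def trunc (n : ℕ) (M : Matrix ℕ ℕ ℝ) : Matrix (Fin n) (Fin n) ℝ :=
  M.submatrix Fin.val Fin.val

/-- Semi-infinite lower bidiagonal matrix: unit diagonal and subdiagonal `ℓ 0, ℓ 1, …`. -/
def lowerBidiag (l : ℕ → ℝ) : Matrix ℕ ℕ ℝ :=
  Matrix.of fun i j => if i = j then 1 else if i = j + 1 then l j else 0

/-- Semi-infinite upper bidiagonal matrix: unit diagonal and superdiagonal `u 0, u 1, …`. -/
def upperBidiag (u : ℕ → ℝ) : Matrix ℕ ℕ ℝ :=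
  Matrix.of fun i j => if i = j then 1 else if j = i + 1 then u i else 0

/-- `T = L₁ ⋯ L_p Δ U_q ⋯ U₁` is a positive bidiagonal factorization of `T`. Here `L k i` stands for
the entry `L_{k|i}` and `U k i` for `U_{k|i}`; the factors are numbered from `k = 1`
and their entries from `i = 0`. Values `L k i` with `k ∉ {1, …, p}` and `U k i` with
`k ∉ {1, …, q}` play no role. -/
structure IsPBF (p q : ℕ) (T : Matrix ℕ ℕ ℝ) (L : ℕ → ℕ → ℝ) (Δ : ℕ → ℝ) (U : ℕ → ℕ → ℝ) :
    Prop where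
  eq_prod : T = infProd
    ((List.range p).map (fun k => lowerBidiag (L (k + 1))) ++
      [Matrix.diagonal Δ] ++
      (List.range q).reverse.map (fun k => upperBidiag (U (k + 1))))
  lower_pos : ∀ k, 1 ≤ k → k ≤ p → ∀ i, 0 < L k i
  diag_pos : ∀ i, 0 < Δ i
  upper_pos : ∀ k, 1 ≤ k → k ≤ q → ∀ i, 0 < U k i

/-- The left recursion polynomials `A^{(a)}_n` of a matrix with `p` subdiagonals: the initial values
`A^{(a)}_0, …, A^{(a)}_{p-1}` form the column `a` of `ν`, and the later ones are obtained by solving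
column `n - p` of `A^{(a)} T = x A^{(a)}` for its term `A^{(a)}_n T_{n,n-p}`. The superscript `a`
is counted from `0`. -/
def leftPoly (T : Matrix ℕ ℕ ℝ) (p : ℕ) (ν : Matrix (Fin p) (Fin p) ℝ) (a : Fin p) : ℕ → ℝ[X]
  | n =>
    if h : n < p then C (ν ⟨n, h⟩ a)
    else C (T n (n - p))⁻¹ *
      ∑ m : Fin n, ((if (m : ℕ) = n - p then X else 0) - C (T m (n - p))) * leftPoly T p ν a m

/-- The right recursion polynomials `B^{(b)}_n` of a matrix with `q` superdiagonals and initial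
condition matrix `ξ`: right eigenvectors of `T` are left eigenvectors of its transpose. -/
def rightPoly (T : Matrix ℕ ℕ ℝ) (q : ℕ) (ξ : Matrix (Fin q) (Fin q) ℝ) (b : Fin q) (n : ℕ) :
    ℝ[X] :=
  leftPoly Tᵀ q ξ b n

theorem leftPoly_init (T : Matrix ℕ ℕ ℝ) (p : ℕ) (ν : Matrix (Fin p) (Fin p) ℝ) (a n : Fin p) :
    leftPoly T p ν a n = C (ν n a) := by
  rw [leftPoly]
  simp

/-- The defining recursion: `∑_{m ≤ n + p} A_m T_{m,n} = x A_n`. -/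
theorem leftPoly_rec (T : Matrix ℕ ℕ ℝ) (p : ℕ) (hp : 1 ≤ p) (ν : Matrix (Fin p) (Fin p) ℝ)
    (a : Fin p) (n : ℕ) (hT : T (n + p) n ≠ 0) :
    ∑ m ∈ Finset.range (n + p + 1), leftPoly T p ν a m * C (T m n) = X * leftPoly T p ν a n := by
  rw [Finset.sum_range_succ]
  have key : leftPoly T p ν a (n + p) * C (T (n + p) n) =
      ∑ m ∈ Finset.range (n + p), ((if m = n then X else 0) - C (T m n)) * leftPoly T p ν a m := by
    rw [leftPoly, dif_neg (by omega), Nat.add_sub_cancel, mul_right_comm, ← C_mul,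
      inv_mul_cancel₀ hT, C_1, one_mul]
    exact Fin.sum_univ_eq_sum_range
      (fun m => ((if m = n then X else 0) - C (T m n)) * leftPoly T p ν a m) (n + p)
  rw [key, ← Finset.sum_add_distrib]
  have h2 : ∀ m ∈ Finset.range (n + p), leftPoly T p ν a m * C (T m n) +
      ((if m = n then X else 0) - C (T m n)) * leftPoly T p ν a m =
      if m = n then X * leftPoly T p ν a m else 0 := by
    intro m _
    split_ifs <;> ring
  rw [Finset.sum_congr rfl h2, Finset.sum_ite_eq', if_pos (Finset.mem_range.2 (by omega))]

/-- The determinantal polynomial built from a family `F^{(c)}_n`, `c = 1, …, r`: the rows of the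
determinant are `(F^{(c)}_n)_c, (F^{(c)}_{N+1})_c, …, (F^{(c)}_{N+r-1})_c`. It is `Q_{n,N}`
for the left and `R_{n,N}` for the right recursion polynomials. -/
def detPoly {r : ℕ} (F : Fin r → ℕ → ℝ[X]) (n N : ℕ) : ℝ[X] :=
  Matrix.det (Matrix.of fun i c : Fin r => F c (if (i : ℕ) = 0 then n else N + i))

/-- The increasing enumeration of `{0, …, r - 1} \ {a}`. -/
def skip {r : ℕ} (a : Fin r) (j : Fin (r - 1)) : Fin r :=
  ⟨if (j : ℕ) < a then j else j + 1, by split_ifs <;> omega⟩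

/-- The determinant with rows `(F^{(c)}_{N+1})_c, …, (F^{(c)}_{N+r-1})_c`, where `c` runs
over all superscripts but `a`. It equals `1` for `r = 1`. -/
def minorPoly {r : ℕ} (F : Fin r → ℕ → ℝ[X]) (a : Fin r) (N : ℕ) : ℝ[X] :=
  Matrix.det (Matrix.of fun i j : Fin (r - 1) => F (skip a j) (N + 1 + i))

/-- `β_N = (-1)^{(q-1)N} T_{0,q} T_{1,q+1} ⋯ T_{N-1,N+q-1}`. -/
def betaCoeff (T : Matrix ℕ ℕ ℝ) (q N : ℕ) : ℝ :=
  (-1) ^ ((q - 1) * N) * ∏ j ∈ Finset.range N, T j (j + q)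

/-- The Christoffel number `ρ^{[N]}_{k,b}` at the node `x = λ^{[N]}_k`; as `b` is counted from `0`,
the sign is `(-1)^b`. -/
def christoffelRho (T : Matrix ℕ ℕ ℝ) (q : ℕ) (ξ : Matrix (Fin q) (Fin q) ℝ)
    (N : ℕ) (x : ℝ) (b : Fin q) : ℝ :=
  (-1) ^ (b : ℕ) * betaCoeff T q N * (minorPoly (rightPoly T q ξ) b N).eval x

/-- The Christoffel number `μ^{[N]}_{k,a}` at the node `x = λ^{[N]}_k`; as `a` is counted from `0`,
the sign is `(-1)^a`. -/
def christoffelMu (T : Matrix ℕ ℕ ℝ) (p q : ℕ) (ν : Matrix (Fin p) (Fin p) ℝ)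
    (ξ : Matrix (Fin q) (Fin q) ℝ) (N : ℕ) (x : ℝ) (a : Fin p) : ℝ :=
  (-1) ^ (a : ℕ) * (minorPoly (leftPoly T p ν) a N).eval x /
    (betaCoeff T q N * ∑ l ∈ Finset.range (N + 1),
      (detPoly (leftPoly T p ν) l N).eval x * (detPoly (rightPoly T q ξ) l N).eval x)

/-- The first vector of the canonical basis. -/
def firstVec (r : ℕ) : Fin r → ℝ := fun i => if (i : ℕ) = 0 then 1 else 0

/-- The matrix `Λ`: its column `c = 0, …, p - 1` is `L₁ ⋯ L_c e₁`, with `p × p` truncated factors,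
divided by `L_{c|0} L_{c-1|1} ⋯ L_{1|c-1}`. -/
def lambdaMat (p : ℕ) (L : ℕ → ℕ → ℝ) : Matrix (Fin p) (Fin p) ℝ :=
  Matrix.of fun i c =>
    (∏ j ∈ Finset.range c, L (c - j) j)⁻¹ *
      ((((List.range c).map fun k => trunc p (lowerBidiag (L (k + 1)))).prod) *ᵥ firstVec p) i

/-- The matrix `Υ`: its row `c = 0, …, q - 1` is `e₁ᵀ U_c ⋯ U₁`, with `q × q` truncated factors,
divided by `U_{c|0} U_{c-1|1} ⋯ U_{1|c-1}`. -/
def upsilonMat (q : ℕ) (U : ℕ → ℕ → ℝ) : Matrix (Fin q) (Fin q) ℝ :=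
  Matrix.of fun c j =>
    (∏ i ∈ Finset.range c, U (c - i) i)⁻¹ *
      (firstVec q ᵥ*
        (((List.range c).reverse.map fun k => trunc q (upperBidiag (U (k + 1)))).prod)) j

/-- Lower triangular with unit diagonal. -/
def IsLowerUnitriangular {r : ℕ} (M : Matrix (Fin r) (Fin r) ℝ) : Prop :=
  (∀ i, M i i = 1) ∧ ∀ i j, i < j → M i j = 0

/-- Upper triangular with unit diagonal. -/
def IsUpperUnitriangular {r : ℕ} (M : Matrix (Fin r) (Fin r) ℝ) : Prop :=
  (∀ i, M i i = 1) ∧ ∀ i j, j < i → M i j = 0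

end MixedBanded

end

/-! Let `w` be the last column of the adjugate of `x - T^{[N]}` (`adjVec`). The recursion and
Cramer's rule give `w_n = β_N R_{n,N}(x)`, and expanding `R_{n,N}` along its first row for `n < q`
gives `w = ξ ρ` on these indices. Hence `ρ = ξ⁻¹ w = ℬ (Υ w)`, and entry `c` of `Υ w` (counted from
`0`) is a positive multiple of the first entry of `U_c ⋯ U_1 w`. It suffices that these first
entries are positive when `x` is an eigenvalue.

The tool is variation diminution: a positive bidiagonal factor never creates sign alternations. If
`w` and `T w` have the same signs, every intermediate vector has as many alternations as `w`, with
the same starting sign. Then no factor can cancel an extreme nonzero entry; an upper factor moves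
the first one to the left and a lower factor moves the last one to the right, unless it is already
at the end. So eigenvectors of truncations have nonzero first and last entries, and all `U_c ⋯ U_1
w` start with the sign of `w_0` (`UpperStep.first`, `LowerStep.last`, `first_mul_pos_of_chain`).

Let `P_n` be the characteristic polynomial of the leading `n × n` block. The same tool shows that
`P_N` and `P_{N+2}` have opposite signs at the zeros of `P_{N+1}` (`IsPBF.sturm`), and positive
determinants fix the signs at `0`. By induction the zeros are positive, simple and strictly
interlacing (`IsPBF.spectrum`). The induction also carries `w_0 > 0`: this holds at each zero of the
smaller polynomial, and at `0`, and `w_0` cannot vanish on the way up to the next zero of the larger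
one.

For `μ`, the numerator is a number `ρ` of `Tᵀ` up to a factor `β`. The adjugate identity turns the
denominator, up to the same factor, into `P_{N+1}' P_N` at the eigenvalue, positive by interlacing.
-/

noncomputable section
namespace MixedBanded

/-! ### Sign alternations under positive bidiagonal steps. -/

/-- `x` has, inside the window `[a, b)`, a subsequence of length `k + 1` with strictly alternating
signs, the first of which is the sign of `ε`. -/
def HasAlt (a b : ℕ) (x : ℕ → ℝ) (k : ℕ) (ε : ℝ) : Prop :=
  ∃ f : ℕ → ℕ, (∀ j < k, f j < f (j + 1)) ∧
    ∀ j ≤ k, a ≤ f j ∧ f j < b ∧ 0 < ε * (-1) ^ j * x (f j)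

/-- `y` arises from `x` by a positive lower bidiagonal matrix of size `n`. -/
def LowerStep (n : ℕ) (x y : ℕ → ℝ) : Prop :=
  ∃ l : ℕ → ℝ, (∀ i, 0 < l i) ∧ y 0 = x 0 ∧ ∀ i, i + 1 < n → y (i + 1) = x (i + 1) + l i * x i

/-- `y` arises from `x` by a positive upper bidiagonal matrix of size `n`. -/
def UpperStep (n : ℕ) (x y : ℕ → ℝ) : Prop :=
  ∃ u : ℕ → ℝ, (∀ i, 0 < u i) ∧ (∀ i, i + 1 < n → y i = x i + u i * x (i + 1)) ∧
    ∀ i, i + 1 = n → y i = x i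

/-- `y` arises from `x` by a positive diagonal matrix of size `n`. -/
def DiagStep (n : ℕ) (x y : ℕ → ℝ) : Prop :=
  ∃ d : ℕ → ℝ, (∀ i, 0 < d i) ∧ ∀ i, i < n → y i = d i * x i

/-- `y` arises from `x` by a positive bidiagonal or diagonal matrix of size `n`. -/
def BidiagStep (n : ℕ) (x y : ℕ → ℝ) : Prop :=
  LowerStep n x y ∨ UpperStep n x y ∨ DiagStep n x y

/-- `x` has an alternating subsequence of length `s + 1` starting with the sign of `ε`, and
none that is longer. -/
def MaxAlt (n s : ℕ) (ε : ℝ) (x : ℕ → ℝ) : Prop :=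
  HasAlt 0 n x s ε ∧ ∀ ε', ¬ HasAlt 0 n x (s + 1) ε'

theorem HasAlt.mono {a b a' b' : ℕ} {x : ℕ → ℝ} {k : ℕ} {ε : ℝ} (h : HasAlt a b x k ε)
    (ha : a' ≤ a) (hb : b ≤ b') : HasAlt a' b' x k ε := by
  obtain ⟨f, hf, h⟩ := h
  exact ⟨f, hf, fun j hj => ⟨ha.trans (h j hj).1, (h j hj).2.1.trans_le hb, (h j hj).2.2⟩⟩

theorem HasAlt.shrink_left {a b : ℕ} {x : ℕ → ℝ} {k : ℕ} {ε : ℝ} (h : HasAlt a b x k ε)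
    (ha : x a = 0) : HasAlt (a + 1) b x k ε := by
  obtain ⟨f, hf, h⟩ := h
  refine ⟨f, hf, fun j hj => ⟨?_, (h j hj).2⟩⟩
  have h1 := h j hj
  rcases h1.1.eq_or_lt with h2 | h2
  · rw [← h2, ha] at h1
    simp at h1
  · exact h2

theorem HasAlt.shrink_right {a b : ℕ} {x : ℕ → ℝ} {k : ℕ} {ε : ℝ} (h : HasAlt a (b + 1) x k ε)
    (hb : x b = 0) : HasAlt a b x k ε := by
  obtain ⟨f, hf, h⟩ := h
  refine ⟨f, hf, fun j hj => ⟨(h j hj).1, ?_, (h j hj).2.2⟩⟩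
  have h1 := h j hj
  rcases (Nat.lt_succ_iff.1 h1.2.1).eq_or_lt with h2 | h2
  · rw [h2, hb] at h1
    simp at h1
  · exact h2

/-- Each entry of `y` borrows its sign from an entry of `x` at the same or the neighbouring index,
always on the same side. The chosen indices are therefore weakly increasing, and consecutive ones
differ because they carry opposite signs. -/
theorem HasAlt.of_near {a b : ℕ} {x y : ℕ → ℝ}
    (h : (∀ i, a ≤ i → i < b → ∀ ε : ℝ, 0 < ε * y i →
        ∃ i', i' ≤ i ∧ i ≤ i' + 1 ∧ a ≤ i' ∧ 0 < ε * x i') ∨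
      (∀ i, a ≤ i → i < b → ∀ ε : ℝ, 0 < ε * y i →
        ∃ i', i ≤ i' ∧ i' ≤ i + 1 ∧ i' < b ∧ 0 < ε * x i'))
    {k : ℕ} {ε : ℝ} (hy : HasAlt a b y k ε) : HasAlt a b x k ε := by
  obtain ⟨f, hf, hy⟩ := hy
  have key : ∃ g : ℕ → ℕ, ∀ j ≤ k, a ≤ g j ∧ g j < b ∧ 0 < ε * (-1) ^ j * x (g j) ∧
      ∀ j' ≤ k, f j < f j' → g j ≤ g j' := by
    rcases h with h | h
    · have : ∀ j, ∃ i', j ≤ k → i' ≤ f j ∧ f j ≤ i' + 1 ∧ a ≤ i' ∧ 0 < ε * (-1) ^ j * x i' := by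
        intro j
        by_cases hj : j ≤ k
        · obtain ⟨i', hi⟩ := h (f j) (hy j hj).1 (hy j hj).2.1 _ (hy j hj).2.2
          exact ⟨i', fun _ => hi⟩
        · exact ⟨0, fun h => absurd h hj⟩
      choose g hg using this
      refine ⟨g, fun j hj => ⟨(hg j hj).2.2.1, (hg j hj).1.trans_lt (hy j hj).2.1,
        (hg j hj).2.2.2, fun j' hj' hlt => ?_⟩⟩
      have h1 := hg j hj
      have h2 := hg j' hj'
      omega
    · have : ∀ j, ∃ i', j ≤ k → f j ≤ i' ∧ i' ≤ f j + 1 ∧ i' < b ∧ 0 < ε * (-1) ^ j * x i' := by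
        intro j
        by_cases hj : j ≤ k
        · obtain ⟨i', hi⟩ := h (f j) (hy j hj).1 (hy j hj).2.1 _ (hy j hj).2.2
          exact ⟨i', fun _ => hi⟩
        · exact ⟨0, fun h => absurd h hj⟩
      choose g hg using this
      refine ⟨g, fun j hj => ⟨(hy j hj).1.trans (hg j hj).1, (hg j hj).2.2.1,
        (hg j hj).2.2.2, fun j' hj' hlt => ?_⟩⟩
      have h1 := hg j hj
      have h2 := hg j' hj'
      omega
  obtain ⟨g, hg⟩ := key
  refine ⟨g, fun j hj => ?_, fun j hj => ⟨(hg j hj).1, (hg j hj).2.1, (hg j hj).2.2.1⟩⟩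
  refine lt_of_le_of_ne ((hg j hj.le).2.2.2 (j + 1) hj (hf j hj)) fun heq => ?_
  have h1 := (hg j hj.le).2.2.1
  have h2 := (hg (j + 1) hj).2.2.1
  rw [← heq, pow_succ] at h2
  linarith

/-- Nothing to the right of an entry is read, so every initial window is allowed; `LowerStep.last`
uses the window without the last index. -/
theorem LowerStep.hasAlt {n : ℕ} {x y : ℕ → ℝ} (h : LowerStep n x y) {b k : ℕ} (hb : b ≤ n)
    {ε : ℝ} (hy : HasAlt 0 b y k ε) : HasAlt 0 b x k ε := by
  obtain ⟨l, hl, h0, h⟩ := h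
  refine HasAlt.of_near (Or.inl fun i _ hi ε hε => ?_) hy
  rcases i with _ | i
  · exact ⟨0, le_rfl, by omega, le_rfl, by rwa [← h0]⟩
  · by_cases h1 : 0 < ε * x (i + 1)
    · exact ⟨i + 1, le_rfl, by omega, by omega, h1⟩
    · refine ⟨i, by omega, le_rfl, by omega, ?_⟩
      rw [h i (by omega)] at hε
      have := hl i
      by_contra h2
      have := mul_nonneg this.le (neg_nonneg.2 (not_lt.1 h2))
      nlinarith

theorem UpperStep.hasAlt {n : ℕ} {x y : ℕ → ℝ} (h : UpperStep n x y) {a k : ℕ}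
    {ε : ℝ} (hy : HasAlt a n y k ε) : HasAlt a n x k ε := by
  obtain ⟨l, hl, h, h0⟩ := h
  refine HasAlt.of_near (Or.inr fun i _ hi ε hε => ?_) hy
  by_cases h1 : 0 < ε * x i
  · exact ⟨i, le_rfl, by omega, by omega, h1⟩
  by_cases h3 : i + 1 = n
  · rw [h0 i h3] at hε
    exact absurd hε h1
  · refine ⟨i + 1, by omega, le_rfl, by omega, ?_⟩
    rw [h i (by omega)] at hε
    have := hl i
    by_contra h2
    have := mul_nonneg this.le (neg_nonneg.2 (not_lt.1 h2))
    nlinarith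

theorem HasAlt.of_sign {a b : ℕ} {x y : ℕ → ℝ} (h : ∀ i < b, y i ≠ 0 → 0 < y i * x i)
    {k : ℕ} {ε : ℝ} (hy : HasAlt a b y k ε) : HasAlt a b x k ε := by
  obtain ⟨f, hf, hy⟩ := hy
  refine ⟨f, hf, fun j hj => ⟨(hy j hj).1, (hy j hj).2.1, ?_⟩⟩
  obtain ⟨h1, h2, h3⟩ := hy j hj
  have h4 : y (f j) ≠ 0 := by
    intro h0
    simp [h0] at h3
  have h5 := h _ h2 h4
  have : 0 < (ε * (-1) ^ j * x (f j)) * (y (f j)) ^ 2 := by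
    have := mul_pos h3 h5
    nlinarith
  exact pos_of_mul_pos_left this (sq_nonneg _)

theorem BidiagStep.hasAlt {n : ℕ} {x y : ℕ → ℝ} (h : BidiagStep n x y) {k : ℕ}
    {ε : ℝ} (hy : HasAlt 0 n y k ε) : HasAlt 0 n x k ε := by
  rcases h with h | h | ⟨d, hd, h⟩
  · exact h.hasAlt le_rfl hy
  · exact h.hasAlt hy
  · refine hy.of_sign fun i hi h0 => ?_
    rw [h i hi] at h0 ⊢
    have : x i ≠ 0 := right_ne_zero_of_mul h0
    rw [mul_assoc]
    exact mul_pos (hd i) (mul_self_pos.2 this)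

theorem HasAlt.of_chain {n : ℕ} {x y : ℕ → ℝ} (h : Relation.ReflTransGen (BidiagStep n) x y)
    {k : ℕ} {ε : ℝ} (hy : HasAlt 0 n y k ε) : HasAlt 0 n x k ε := by
  induction h with
  | refl => exact hy
  | tail _ h ih => exact ih (h.hasAlt hy)

/-- As all earlier entries vanish, the alternation starts beyond `i`, and entry `i` can be put in
front of it. This pins the sign of the first nonzero entry when the alternation is maximal. -/
theorem HasAlt.cons {a b : ℕ} {x : ℕ → ℝ} {k : ℕ} {ε : ℝ} (h : HasAlt a b x k ε)
    {i : ℕ} (hai : a ≤ i) (hi : ∀ j, a ≤ j → j < i → x j = 0) (hx : ε * x i < 0) :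
    HasAlt a b x (k + 1) (-ε) := by
  obtain ⟨f, hf, h⟩ := h
  have h0 := h 0 (Nat.zero_le _)
  have hlt : i < f 0 := by
    by_contra hle
    rcases (not_lt.1 hle).eq_or_lt with h1 | h1
    · rw [h1] at h0
      simp only [pow_zero, mul_one] at h0
      linarith [h0.2.2]
    · have := h0.2.2
      rw [hi _ h0.1 h1] at this
      simp at this
  refine ⟨fun j => Nat.casesOn j i f, fun j hj => ?_, fun j hj => ?_⟩
  · rcases j with _ | j
    · exact hlt
    · exact hf j (by omega)
  · rcases j with _ | j
    · refine ⟨hai, hlt.trans h0.2.1, ?_⟩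
      have h1 : 0 < -ε * (-1) ^ 0 * x i := by
        rw [pow_zero]
        linarith
      exact h1
    · have := h j (by omega)
      refine ⟨this.1, this.2.1, ?_⟩
      rw [pow_succ]
      linarith [this.2.2]

theorem HasAlt.snoc {a b : ℕ} {x : ℕ → ℝ} {k : ℕ} {ε : ℝ} (h : HasAlt a b x k ε)
    {i : ℕ} (hib : i < b) (hi : ∀ j, i < j → j < b → x j = 0) (hx : ε * (-1) ^ k * x i < 0) :
    HasAlt a b x (k + 1) ε := by
  obtain ⟨f, hf, h⟩ := h
  have h0 := h k le_rfl
  have hlt : f k < i := by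
    by_contra hle
    rcases (not_lt.1 hle).eq_or_lt with h1 | h1
    · rw [← h1] at h0
      linarith [h0.2.2]
    · have := h0.2.2
      rw [hi _ h1 h0.2.1] at this
      simp at this
  refine ⟨fun j => if j ≤ k then f j else i, fun j hj => ?_, fun j hj => ?_⟩
  · by_cases hjk : j + 1 ≤ k
    · simpa [hjk, (Nat.le_succ j).trans hjk] using hf j hjk
    · obtain rfl : j = k := by omega
      simpa using hlt
  · by_cases hjk : j ≤ k
    · simpa [hjk] using h j hjk
    · obtain rfl : j = k + 1 := by omega
      simp only [hjk, if_false]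
      refine ⟨by omega, hib, ?_⟩
      rw [pow_succ]
      linarith

theorem MaxAlt.first_nonneg {n s : ℕ} {ε : ℝ} {x : ℕ → ℝ} (h : MaxAlt n s ε x) :
    0 ≤ ε * x 0 := by
  by_contra hlt
  exact h.2 _ (h.1.cons le_rfl (by intro j h1 h2; omega) (not_le.1 hlt))

theorem MaxAlt.last_nonneg {n s : ℕ} {ε : ℝ} {x : ℕ → ℝ} (h : MaxAlt n s ε x) {i : ℕ}
    (hin : i < n) (hi : ∀ j, i < j → j < n → x j = 0) : 0 ≤ ε * (-1) ^ s * x i := by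
  by_contra hlt
  exact h.2 _ (h.1.snoc hin hi (not_le.1 hlt))

theorem MaxAlt.ne_zero {n s : ℕ} {ε : ℝ} {x : ℕ → ℝ} (h : MaxAlt n s ε x) : ε ≠ 0 := by
  rintro rfl
  obtain ⟨f, -, h⟩ := h.1
  simpa using (h 0 (Nat.zero_le _)).2.2

theorem HasAlt.lt {a b : ℕ} {x : ℕ → ℝ} {k : ℕ} {ε : ℝ} (h : HasAlt a b x k ε) : k < b := by
  obtain ⟨f, hf, h⟩ := h
  have : ∀ j ≤ k, j ≤ f j := by
    intro j
    induction j with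
    | zero => intro _; omega
    | succ j ih =>
      intro hj
      have := hf j hj
      have := ih (by omega)
      omega
  exact (this k le_rfl).trans_lt (h k le_rfl).2.1

theorem exists_maxAlt {n : ℕ} {x : ℕ → ℝ} {i : ℕ} (hi : i < n) (hx : x i ≠ 0) :
    ∃ s ε, MaxAlt n s ε x := by
  classical
  have h0 : ∃ ε, HasAlt 0 n x 0 ε :=
    ⟨x i, fun _ => i, by simp, fun j hj => by
      obtain rfl : j = 0 := by omega
      exact ⟨by omega, hi, by simpa using mul_self_pos.2 hx⟩⟩
  have hP := Nat.findGreatest_spec (P := fun s => ∃ ε, HasAlt 0 n x s ε) (Nat.zero_le n) h0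
  obtain ⟨ε, hε⟩ := hP
  refine ⟨_, ε, hε, fun ε' h' => ?_⟩
  have := Nat.le_findGreatest (P := fun s => ∃ ε, HasAlt 0 n x s ε) h'.lt.le ⟨ε', h'⟩
  omega

theorem exists_first {P : ℕ → Prop} {m : ℕ} (h : ∃ i ≤ m, P i) :
    ∃ i ≤ m, P i ∧ ∀ j < i, ¬ P j := by
  classical
  obtain ⟨i, hi, hP⟩ := h
  exact ⟨Nat.find ⟨i, hP⟩, (Nat.find_min' _ hP).trans hi, Nat.find_spec ⟨i, hP⟩,
    fun j hj => Nat.find_min _ hj⟩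

theorem exists_last {P : ℕ → Prop} {m n : ℕ} (h : ∃ i < n, m ≤ i ∧ P i) :
    ∃ i < n, m ≤ i ∧ P i ∧ ∀ j, i < j → j < n → ¬ P j := by
  classical
  obtain ⟨i, hi, hm, hP⟩ := h
  have hle : i ≤ n - 1 := by omega
  refine ⟨Nat.findGreatest P (n - 1), ?_, hm.trans (Nat.le_findGreatest hle hP),
    Nat.findGreatest_spec hle hP, fun j hj hjn => Nat.findGreatest_is_greatest hj (by omega)⟩
  have := Nat.findGreatest_le (P := P) (n - 1)
  omega

/-- A first nonzero entry at a positive index spills one place to the left. If it is `x 0`, then `y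
0 = 0` would give `x 1` the sign opposite to `ε`; the alternation of `y` would avoid index `0`, pull
back to `x` on the same window, and be lengthened by `x 1`. -/
theorem UpperStep.first {n s : ℕ} {ε : ℝ} {x y : ℕ → ℝ} (h : UpperStep n x y)
    (hx : MaxAlt n s ε x) (hy : MaxAlt n s ε y) {m : ℕ} (hm : m < n)
    (hz : ∃ i ≤ m, x i ≠ 0) : ∃ i ≤ m - 1, y i ≠ 0 := by
  obtain ⟨i, him, hi, hmin⟩ := exists_first hz
  have h' := h
  obtain ⟨u, hu, h1, h2⟩ := h
  rcases i with _ | i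
  · refine ⟨0, by omega, fun hy0 => ?_⟩
    by_cases hn : n = 1
    · rw [h2 0 (by omega)] at hy0
      exact hi hy0
    · have h3 := h'.hasAlt (hy.1.shrink_left hy0)
      have h4 := h1 0 (by omega)
      have h5 : 0 < ε * x 0 := lt_of_le_of_ne hx.first_nonneg (mul_ne_zero hx.ne_zero hi).symm
      have h6 : ε * x (0 + 1) < 0 := by
        have := hu 0
        rw [hy0] at h4
        have h7 : u 0 * (ε * x (0 + 1)) = -(ε * x 0) := by linear_combination -ε * h4
        have h7 : u 0 * (ε * x (0 + 1)) < 0 := by linarith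
        exact neg_of_mul_neg_right h7 this.le
      exact hx.2 _ ((h3.cons le_rfl (by intro j h1 h2; omega) h6).mono (Nat.zero_le _) le_rfl)
  · refine ⟨i, by omega, ?_⟩
    have h3 : x i = 0 := not_not.1 (hmin i (by omega))
    rw [h1 i (by omega), h3, zero_add]
    exact mul_ne_zero (hu i).ne' hi

/-- Mirror image of `UpperStep.first`; the minimum accounts for a last nonzero entry already at
index `n - 1`. -/
theorem LowerStep.last {n s : ℕ} {ε : ℝ} {x y : ℕ → ℝ} (h : LowerStep n x y)
    (hx : MaxAlt n s ε x) (hy : MaxAlt n s ε y) {m : ℕ}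
    (hz : ∃ i < n, m ≤ i ∧ x i ≠ 0) : ∃ i < n, min (m + 1) (n - 1) ≤ i ∧ y i ≠ 0 := by
  obtain ⟨i, hin, him, hi, hmax⟩ := exists_last hz
  have h' := h
  obtain ⟨l, hl, h1, h2⟩ := h
  by_cases hn : i + 1 = n
  · refine ⟨i, hin, by omega, fun hy0 => ?_⟩
    rcases i with _ | i
    · exact hi (h1 ▸ hy0)
    · subst hn
      have h3 := h'.hasAlt (Nat.le_succ _) (hy.1.shrink_right hy0)
      have h4 := h2 i (by omega)
      have h5 : 0 < ε * (-1) ^ s * x (i + 1) :=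
        lt_of_le_of_ne (hx.last_nonneg (by omega) (by intro j h1 h2; omega))
          (mul_ne_zero (mul_ne_zero hx.ne_zero (by simp)) hi).symm
      have h6 : ε * (-1) ^ s * x i < 0 := by
        have := hl i
        rw [hy0] at h4
        have h7 : l i * (ε * (-1) ^ s * x i) = -(ε * (-1) ^ s * x (i + 1)) := by
          linear_combination -(ε * (-1) ^ s) * h4
        have h7 : l i * (ε * (-1) ^ s * x i) < 0 := by linarith
        exact neg_of_mul_neg_right h7 this.le
      exact hx.2 _ ((h3.snoc (by omega) (by intro j h1 h2; omega) h6).mono le_rfl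
        (Nat.le_succ _))
  · refine ⟨i + 1, by omega, by omega, ?_⟩
    have h3 : x (i + 1) = 0 := not_not.1 (hmax (i + 1) (by omega) (by omega))
    rw [h2 i (by omega), h3, zero_add]
    exact mul_ne_zero (hl i).ne' hi

theorem BidiagStep.first {n s : ℕ} {ε : ℝ} {x y : ℕ → ℝ} (h : BidiagStep n x y)
    (hx : MaxAlt n s ε x) (hy : MaxAlt n s ε y) {m : ℕ} (hm : m < n)
    (hz : ∃ i ≤ m, x i ≠ 0) : ∃ i ≤ m, y i ≠ 0 := by
  rcases h with ⟨l, hl, h0, h⟩ | h | ⟨d, hd, h⟩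
  · obtain ⟨i, him, hi, hmin⟩ := exists_first hz
    refine ⟨i, him, ?_⟩
    rcases i with _ | i
    · rwa [h0]
    · rw [h i (by omega), not_not.1 (hmin i (by omega))]
      simpa using hi
  · obtain ⟨i, hi, h⟩ := h.first hx hy hm hz
    exact ⟨i, by omega, h⟩
  · obtain ⟨i, hi, hz⟩ := hz
    refine ⟨i, hi, ?_⟩
    rw [h i (by omega)]
    exact mul_ne_zero (hd i).ne' hz

theorem BidiagStep.last {n s : ℕ} {ε : ℝ} {x y : ℕ → ℝ} (h : BidiagStep n x y)
    (hx : MaxAlt n s ε x) (hy : MaxAlt n s ε y) {m : ℕ}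
    (hz : ∃ i < n, m ≤ i ∧ x i ≠ 0) : ∃ i < n, m ≤ i ∧ y i ≠ 0 := by
  rcases h with h | ⟨u, hu, h, h0⟩ | ⟨d, hd, h⟩
  · obtain ⟨i, hi, h1, h⟩ := h.last hx hy hz
    obtain ⟨j, hj, h2, -⟩ := hz
    exact ⟨i, hi, by omega, h⟩
  · obtain ⟨i, hin, him, hi, hmax⟩ := exists_last hz
    refine ⟨i, hin, him, ?_⟩
    by_cases hn : i + 1 = n
    · rwa [h0 i hn]
    · rw [h i (by omega), not_not.1 (hmax (i + 1) (by omega) (by omega))]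
      simpa using hi
  · obtain ⟨i, hi, hm, hz⟩ := hz
    refine ⟨i, hi, hm, ?_⟩
    rw [h i (by omega)]
    exact mul_ne_zero (hd i).ne' hz

/-! ### Chains of steps between vectors with the same signs. -/

/-- Alternations only decrease along a chain, so a vector between `w` and `y` is squeezed from both
sides. -/
theorem MaxAlt.of_chain {n s : ℕ} {ε : ℝ} {w x y : ℕ → ℝ}
    (hwx : Relation.ReflTransGen (BidiagStep n) w x)
    (hxy : Relation.ReflTransGen (BidiagStep n) x y)
    (hw : ∀ ε', ¬ HasAlt 0 n w (s + 1) ε') (hy : HasAlt 0 n y s ε) : MaxAlt n s ε x :=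
  ⟨hy.of_chain hxy, fun ε' h => hw ε' (h.of_chain hwx)⟩

theorem first_of_chain {n s : ℕ} {ε : ℝ} {w x y : ℕ → ℝ}
    (hwx : Relation.ReflTransGen (BidiagStep n) w x)
    (hxy : Relation.ReflTransGen (BidiagStep n) x y)
    (hw : ∀ ε', ¬ HasAlt 0 n w (s + 1) ε') (hy : HasAlt 0 n y s ε) {m : ℕ} (hm : m < n)
    (hz : ∃ i ≤ m, w i ≠ 0) : ∃ i ≤ m, x i ≠ 0 := by
  induction hwx with
  | refl => exact hz
  | tail h1 h2 ih =>
    have hby := Relation.ReflTransGen.head h2 hxy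
    exact h2.first (MaxAlt.of_chain h1 hby hw hy) (MaxAlt.of_chain (h1.tail h2) hxy hw hy) hm
      (ih hby)

theorem last_of_chain {n s : ℕ} {ε : ℝ} {w x y : ℕ → ℝ}
    (hwx : Relation.ReflTransGen (BidiagStep n) w x)
    (hxy : Relation.ReflTransGen (BidiagStep n) x y)
    (hw : ∀ ε', ¬ HasAlt 0 n w (s + 1) ε') (hy : HasAlt 0 n y s ε) {m : ℕ}
    (hz : ∃ i < n, m ≤ i ∧ w i ≠ 0) : ∃ i < n, m ≤ i ∧ x i ≠ 0 := by
  induction hwx with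
  | refl => exact hz
  | tail h1 h2 ih =>
    have hby := Relation.ReflTransGen.head h2 hxy
    exact h2.last (MaxAlt.of_chain h1 hby hw hy) (MaxAlt.of_chain (h1.tail h2) hxy hw hy)
      (ih hby)

/-- If a product of positive bidiagonal matrices containing an upper one maps `w` to `y` of the same
signs, then `w` starts with a nonzero entry. -/
theorem first_ne_zero_of_chain {n : ℕ} {w x y : ℕ → ℝ} (hwx : UpperStep n w x)
    (hxy : Relation.ReflTransGen (BidiagStep n) x y)
    (hpos : ∀ i < n, w i ≠ 0 → 0 < w i * y i) (hzero : ∀ i, i + 1 < n → w i = 0 → y i = 0)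
    (hne : ∃ i < n, w i ≠ 0) : w 0 ≠ 0 := by
  intro h0
  obtain ⟨i, hi, hwi⟩ := hne
  obtain ⟨s, ε, hs⟩ := exists_maxAlt hi hwi
  have hy := hs.1.of_sign hpos
  obtain ⟨m, hm, hwm, hmin⟩ := exists_first (P := fun i => w i ≠ 0) ⟨i, le_rfl, hwi⟩
  have hm0 : m ≠ 0 := by
    rintro rfl
    exact hwm h0
  have h1 := hwx.first hs (MaxAlt.of_chain (.single (Or.inr (Or.inl hwx))) hxy hs.2 hy)
    (m := m) (by omega) ⟨m, le_rfl, hwm⟩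
  obtain ⟨j, hj, hyj⟩ := first_of_chain hxy .refl
    (fun ε' h => hs.2 ε' (h.of_chain (.single (Or.inr (Or.inl hwx))))) hy (m := m - 1) (by omega) h1
  -- Before index `m` the vector `w` vanishes, hence so does `y`; but the first upper factor has
  -- forced a nonzero entry there.
  exact hyj (hzero j (by omega) (not_not.1 (hmin j (by omega))))

/-- Along a chain of positive bidiagonal matrices between vectors of the same signs the first
entries have the same sign. -/
theorem first_mul_pos_of_chain {n : ℕ} {w x y : ℕ → ℝ} (hn : 0 < n)
    (hwx : Relation.ReflTransGen (BidiagStep n) w x)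
    (hxy : Relation.ReflTransGen (BidiagStep n) x y)
    (hpos : ∀ i < n, w i ≠ 0 → 0 < w i * y i) (h0 : w 0 ≠ 0) : 0 < w 0 * x 0 := by
  obtain ⟨s, ε, hs⟩ := exists_maxAlt hn h0
  have hy := hs.1.of_sign hpos
  have hx := MaxAlt.of_chain hwx hxy hs.2 hy
  obtain ⟨i, hi, hxi⟩ := first_of_chain hwx hxy hs.2 hy hn ⟨0, le_rfl, h0⟩
  obtain rfl : i = 0 := by omega
  have h1 : 0 < ε * w 0 := lt_of_le_of_ne hs.first_nonneg (mul_ne_zero hs.ne_zero h0).symm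
  have h2 : 0 < ε * x 0 := lt_of_le_of_ne hx.first_nonneg (mul_ne_zero hs.ne_zero hxi).symm
  have h3 : 0 < ε ^ 2 * (w 0 * x 0) := by nlinarith [mul_pos h1 h2]
  exact pos_of_mul_pos_right h3 (sq_nonneg _)

/-- If a product of positive bidiagonal matrices ending in a lower one maps `w` to `y`, of the same
signs as far as `w` is nonzero, and the last nonzero entry of `w` is not at the end, then `y` has
a later nonzero entry. -/
theorem last_of_lower_chain {n : ℕ} {w x y : ℕ → ℝ}
    (hwx : Relation.ReflTransGen (BidiagStep n) w x) (hxy : LowerStep n x y)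
    (hpos : ∀ i < n, w i ≠ 0 → 0 < w i * y i) {m : ℕ} (hm : m + 1 < n) (hne : w m ≠ 0) :
    ∃ i < n, m + 1 ≤ i ∧ y i ≠ 0 := by
  obtain ⟨s, ε, hs⟩ := exists_maxAlt (n := n) (by omega) hne
  have hy := hs.1.of_sign hpos
  have hxy' : Relation.ReflTransGen (BidiagStep n) x y := .single (Or.inl hxy)
  have hx := last_of_chain hwx hxy' hs.2 hy (m := m) ⟨m, by omega, le_rfl, hne⟩
  obtain ⟨i, hi, h1, h2⟩ := hxy.last (MaxAlt.of_chain hwx hxy' hs.2 hy)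
    (MaxAlt.of_chain (hwx.trans hxy') .refl hs.2 hy) hx
  exact ⟨i, hi, by omega, h2⟩

/-- The final lower factor carries the last nonzero index to `n + 1`. The last nonzero entries of
`w` and `y` both have the sign ending a maximal alternation, which is common to the two vectors. -/
theorem last_mul_pos_of_chain {n : ℕ} {w x y : ℕ → ℝ}
    (hwx : Relation.ReflTransGen (BidiagStep (n + 2)) w x) (hxy : LowerStep (n + 2) x y)
    (hpos : ∀ i < n + 2, w i ≠ 0 → 0 < w i * y i) (h0 : w (n + 1) = 0) (h1 : w n ≠ 0) :
    0 < w n * y (n + 1) := by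
  obtain ⟨s, ε, hs⟩ := exists_maxAlt (n := n + 2) (by omega) h1
  have hy := hs.1.of_sign hpos
  obtain ⟨i, hi, h2, hyi⟩ := last_of_lower_chain hwx hxy hpos (by omega) h1
  obtain rfl : i = n + 1 := by omega
  have hy' := MaxAlt.of_chain (hwx.tail (Or.inl hxy)) .refl hs.2 hy
  have hn : ∀ j, n < j → j < n + 2 → w j = 0 := by
    intro j hj hj'
    obtain rfl : j = n + 1 := by omega
    exact h0
  have hε : ε * (-1) ^ s ≠ 0 := mul_ne_zero hs.ne_zero (by simp)
  have h3 : 0 < ε * (-1) ^ s * w n :=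
    lt_of_le_of_ne (hs.last_nonneg (by omega) hn) (mul_ne_zero hε h1).symm
  have h4 : 0 < ε * (-1) ^ s * y (n + 1) :=
    lt_of_le_of_ne (hy'.last_nonneg (by omega) (by intro j hj hj'; omega))
      (mul_ne_zero hε hyi).symm
  have h5 : 0 < (ε * (-1) ^ s) ^ 2 * (w n * y (n + 1)) := by
    have := mul_pos h3 h4
    nlinarith
  exact pos_of_mul_pos_right h5 (sq_nonneg _)

/-! ### The factorization of `T` as a chain of steps. -/

/-- Action of a lower bidiagonal matrix on a column vector. -/
def lowerAct (l x : ℕ → ℝ) (i : ℕ) : ℝ := x i + if i = 0 then 0 else l (i - 1) * x (i - 1)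

/-- Action of an upper bidiagonal matrix on a column vector. -/
def upperAct (u x : ℕ → ℝ) (i : ℕ) : ℝ := x i + u i * x (i + 1)

/-- The column vector `U_c ⋯ U_1 x`. -/
def upperIter (U : ℕ → ℕ → ℝ) : ℕ → (ℕ → ℝ) → ℕ → ℝ
  | 0, x => x
  | c + 1, x => upperAct (U (c + 1)) (upperIter U c x)

/-- The column vector `L_{k₁ + 1} ⋯ L_{k_r + 1} x` for a list `[k₁, …, k_r]`. -/
def lowerFold (L : ℕ → ℕ → ℝ) (ks : List ℕ) (x : ℕ → ℝ) : ℕ → ℝ :=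
  ks.foldr (fun k y => lowerAct (L (k + 1)) y) x

/-- Product of the first `n` columns of `M` with the first `n` entries of `w`. -/
def act (M : Matrix ℕ ℕ ℝ) (n : ℕ) (w : ℕ → ℝ) (i : ℕ) : ℝ := ∑ j ∈ Finset.range n, M i j * w j

theorem infMul_eq_sum {F K : Matrix ℕ ℕ ℝ} {i j : ℕ} (s : Finset ℕ)
    (h : ∀ k, k ∉ s → F i k * K k j = 0) : infMul F K i j = ∑ k ∈ s, F i k * K k j := by
  refine finsum_eq_sum_of_support_subset _ fun k hk => ?_
  by_contra hks
  exact hk (h k hks)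

theorem infMul_lowerBidiag (l : ℕ → ℝ) (K : Matrix ℕ ℕ ℝ) (i j : ℕ) :
    infMul (lowerBidiag l) K i j = lowerAct l (fun k => K k j) i := by
  rcases i with _ | i
  · rw [infMul_eq_sum {0}]
    · simp [lowerBidiag, lowerAct]
    · intro k hk
      rw [Finset.mem_singleton] at hk
      simp [lowerBidiag, Ne.symm hk]
  · rw [infMul_eq_sum {i + 1, i}]
    · rw [Finset.sum_pair (by omega)]
      simp [lowerBidiag, lowerAct]
    · intro k hk
      simp only [Finset.mem_insert, Finset.mem_singleton, not_or] at hk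
      simp [lowerBidiag, Ne.symm hk.1, Ne.symm hk.2]

theorem infMul_upperBidiag (u : ℕ → ℝ) (K : Matrix ℕ ℕ ℝ) (i j : ℕ) :
    infMul (upperBidiag u) K i j = upperAct u (fun k => K k j) i := by
  rw [infMul_eq_sum {i, i + 1}]
  · rw [Finset.sum_pair (by omega)]
    simp [upperBidiag, upperAct]
  · intro k hk
    simp only [Finset.mem_insert, Finset.mem_singleton, not_or] at hk
    simp [upperBidiag, Ne.symm hk.1, hk.2]

theorem infMul_diagonal (d : ℕ → ℝ) (K : Matrix ℕ ℕ ℝ) (i j : ℕ) :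
    infMul (Matrix.diagonal d) K i j = d i * K i j := by
  rw [infMul_eq_sum {i}]
  · simp
  · intro k hk
    rw [Finset.mem_singleton] at hk
    simp [Matrix.diagonal_apply_ne _ (Ne.symm hk)]

theorem act_lowerBidiag (l : ℕ → ℝ) (K : Matrix ℕ ℕ ℝ) (n : ℕ) (w : ℕ → ℝ) :
    act (infMul (lowerBidiag l) K) n w = lowerAct l (act K n w) := by
  funext i
  simp only [act, infMul_lowerBidiag, lowerAct, add_mul, Finset.sum_add_distrib]
  congr 1
  split_ifs
  · simp
  · simp [Finset.mul_sum, mul_assoc]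

theorem act_upperBidiag (u : ℕ → ℝ) (K : Matrix ℕ ℕ ℝ) (n : ℕ) (w : ℕ → ℝ) :
    act (infMul (upperBidiag u) K) n w = upperAct u (act K n w) := by
  funext i
  simp only [act, infMul_upperBidiag, upperAct, add_mul, Finset.sum_add_distrib, Finset.mul_sum,
    mul_assoc]

theorem act_diagonal (d : ℕ → ℝ) (K : Matrix ℕ ℕ ℝ) (n : ℕ) (w : ℕ → ℝ) :
    act (infMul (Matrix.diagonal d) K) n w = fun i => d i * act K n w i := by
  funext i
  simp only [act, infMul_diagonal, Finset.mul_sum, mul_assoc]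

theorem act_one {n : ℕ} {w : ℕ → ℝ} (hw : ∀ i, n ≤ i → w i = 0) : act 1 n w = w := by
  funext i
  simp only [act, Matrix.one_apply, ite_mul, one_mul, zero_mul, Finset.sum_ite_eq,
    Finset.mem_range]
  split_ifs with h
  · rfl
  · exact (hw i (by omega)).symm

/-- The support condition makes the identity act trivially on `w`. Rows are not truncated, so rows
beyond the window of `w` are available too. -/
theorem IsPBF.act_eq {p q : ℕ} {T : Matrix ℕ ℕ ℝ} {L : ℕ → ℕ → ℝ} {Δ : ℕ → ℝ} {U : ℕ → ℕ → ℝ}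
    (h : IsPBF p q T L Δ U) {n : ℕ} {w : ℕ → ℝ} (hw : ∀ i, n ≤ i → w i = 0) :
    act T n w = lowerFold L (List.range p) (fun i => Δ i * upperIter U q w i) := by
  have hup : ∀ c, act (infProd ((List.range c).reverse.map fun k => upperBidiag (U (k + 1)))) n w =
      upperIter U c w := by
    intro c
    induction c with
    | zero => exact act_one hw
    | succ c ih =>
      rw [List.range_succ, List.reverse_append]
      simp only [List.reverse_singleton, List.singleton_append, List.map_cons, infProd,
        List.foldr_cons]
      rw [act_upperBidiag]
      change upperAct _ (act (infProd _) n w) = _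
      rw [ih]
      rfl
  rw [h.eq_prod, infProd, List.foldr_append, List.foldr_append]
  have hlo : ∀ (ks : List ℕ) (K : Matrix ℕ ℕ ℝ),
      act ((ks.map fun k => lowerBidiag (L (k + 1))).foldr infMul K) n w =
        lowerFold L ks (act K n w) := by
    intro ks K
    induction ks with
    | nil => rfl
    | cons k ks ih =>
      simp only [List.map_cons, List.foldr_cons, act_lowerBidiag, ih]
      rfl
  rw [hlo]
  congr 1
  simp only [List.foldr_cons, List.foldr_nil]
  rw [act_diagonal]
  funext i
  rw [← hup]
  rfl

theorem upperIter_supp (U : ℕ → ℕ → ℝ) {n : ℕ} {w : ℕ → ℝ} (hw : ∀ i, n ≤ i → w i = 0) (c : ℕ) :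
    ∀ i, n ≤ i → upperIter U c w i = 0 := by
  induction c with
  | zero => exact hw
  | succ c ih =>
    intro i hi
    simp [upperIter, upperAct, ih i hi, ih (i + 1) (by omega)]

theorem upperAct_step {u : ℕ → ℝ} (hu : ∀ i, 0 < u i) {n : ℕ} {x : ℕ → ℝ} (hx : x n = 0) :
    UpperStep n x (upperAct u x) :=
  ⟨u, hu, fun _ _ => rfl, fun i hi => by simp [upperAct, hi, hx]⟩

theorem lowerAct_step {l : ℕ → ℝ} (hl : ∀ i, 0 < l i) (n : ℕ) (x : ℕ → ℝ) :
    LowerStep n x (lowerAct l x) :=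
  ⟨l, hl, by simp [lowerAct], fun i _ => by simp [lowerAct]⟩

theorem upperIter_chain {U : ℕ → ℕ → ℝ} {n : ℕ} {w : ℕ → ℝ} (hw : ∀ i, n ≤ i → w i = 0)
    {a b : ℕ} (hab : a ≤ b) (hU : ∀ k, 1 ≤ k → k ≤ b → ∀ i, 0 < U k i) :
    Relation.ReflTransGen (BidiagStep n) (upperIter U a w) (upperIter U b w) := by
  induction b, hab using Nat.le_induction with
  | base => exact .refl
  | succ b hab ih =>
    exact (ih fun k h1 h2 => hU k h1 (by omega)).tail
      (Or.inr (Or.inl (upperAct_step (hU _ (by omega) le_rfl) (upperIter_supp U hw b n le_rfl))))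

theorem lowerFold_chain {L : ℕ → ℕ → ℝ} (n : ℕ) (ks : List ℕ)
    (hL : ∀ k ∈ ks, ∀ i, 0 < L (k + 1) i) (x : ℕ → ℝ) :
    Relation.ReflTransGen (BidiagStep n) x (lowerFold L ks x) := by
  induction ks with
  | nil => exact .refl
  | cons k ks ih =>
    exact (ih fun k hk => hL k (List.mem_cons_of_mem _ hk)).tail
      (Or.inl (lowerAct_step (hL k List.mem_cons_self) n _))

section
variable {p q : ℕ} {T : Matrix ℕ ℕ ℝ} {L : ℕ → ℕ → ℝ} {Δ : ℕ → ℝ} {U : ℕ → ℕ → ℝ}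

theorem IsPBF.lower_mem (h : IsPBF p q T L Δ U) : ∀ k ∈ List.range p, ∀ i, 0 < L (k + 1) i :=
  fun k hk => h.lower_pos _ (by omega) (by have := List.mem_range.1 hk; omega)

theorem IsPBF.chain_of_upper (h : IsPBF p q T L Δ U) {n : ℕ} {w : ℕ → ℝ}
    (hw : ∀ i, n ≤ i → w i = 0) {c : ℕ} (hc : c ≤ q) :
    Relation.ReflTransGen (BidiagStep n) (upperIter U c w) (act T n w) := by
  rw [h.act_eq hw]
  refine (upperIter_chain hw hc h.upper_pos).trans (.trans ?_ (lowerFold_chain n _ h.lower_mem _))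
  exact .single (Or.inr (Or.inr ⟨Δ, h.diag_pos, fun _ _ => rfl⟩))

/-- The factor split off is `L₁`, the last one to act. -/
theorem IsPBF.chain_to_lower (h : IsPBF p q T L Δ U) (hp : 1 ≤ p) {n : ℕ} {w : ℕ → ℝ}
    (hw : ∀ i, n ≤ i → w i = 0) :
    ∃ x, Relation.ReflTransGen (BidiagStep n) w x ∧ LowerStep n x (act T n w) := by
  rw [h.act_eq hw]
  obtain ⟨p, rfl⟩ : ∃ p', p = p' + 1 := ⟨p - 1, by omega⟩
  rw [List.range_succ_eq_map]
  have hL := h.lower_mem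
  rw [List.range_succ_eq_map] at hL
  refine ⟨lowerFold L ((List.range p).map Nat.succ) (fun i => Δ i * upperIter U q w i), ?_, ?_⟩
  · refine (upperIter_chain hw (Nat.zero_le q) h.upper_pos).trans
      (.trans ?_ (lowerFold_chain n _ (fun k hk => hL k (List.mem_cons_of_mem _ hk)) _))
    exact .single (Or.inr (Or.inr ⟨Δ, h.diag_pos, fun _ _ => rfl⟩))
  · exact lowerAct_step (hL 0 List.mem_cons_self) n _

/-- A vector on which `T` preserves signs starts with a nonzero entry. -/
theorem IsPBF.first_ne_zero (h : IsPBF p q T L Δ U) (hq : 1 ≤ q) {n : ℕ} {w : ℕ → ℝ}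
    (hw : ∀ i, n ≤ i → w i = 0) (hpos : ∀ i < n, w i ≠ 0 → 0 < w i * act T n w i)
    (hzero : ∀ i, i + 1 < n → w i = 0 → act T n w i = 0) (hne : ∃ i < n, w i ≠ 0) : w 0 ≠ 0 :=
  first_ne_zero_of_chain (upperAct_step (h.upper_pos 1 le_rfl hq) (hw n le_rfl))
    (h.chain_of_upper hw hq) hpos hzero hne

theorem IsPBF.upperIter_pos (h : IsPBF p q T L Δ U) {n : ℕ} (hn : 0 < n) {w : ℕ → ℝ}
    (hw : ∀ i, n ≤ i → w i = 0) (hpos : ∀ i < n, w i ≠ 0 → 0 < w i * act T n w i)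
    (h0 : 0 < w 0) {c : ℕ} (hc : c ≤ q) : 0 < upperIter U c w 0 :=
  pos_of_mul_pos_right (first_mul_pos_of_chain hn
    (upperIter_chain hw (Nat.zero_le c) fun k h1 h2 => h.upper_pos k h1 (by omega))
    (h.chain_of_upper hw hc) hpos h0.ne') h0.le

theorem IsPBF.last_mul_pos (h : IsPBF p q T L Δ U) (hp : 1 ≤ p) {n : ℕ} {w : ℕ → ℝ}
    (hw : ∀ i, n + 1 ≤ i → w i = 0) (hpos : ∀ i < n + 1, w i ≠ 0 → 0 < w i * act T (n + 1) w i)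
    (h1 : w n ≠ 0) : 0 < w n * act T (n + 1) w (n + 1) := by
  -- Padding `w` by one zero enlarges the window enough to contain row `n + 1`.
  have hw' : ∀ i, n + 2 ≤ i → w i = 0 := fun i hi => hw i (by omega)
  have hact : act T (n + 1) w = act T (n + 2) w := by
    funext i
    simp [act, Finset.sum_range_succ _ (n + 1), hw (n + 1) le_rfl]
  rw [hact] at hpos ⊢
  obtain ⟨x, hx, hxy⟩ := h.chain_to_lower hp hw'
  refine last_mul_pos_of_chain hx hxy (fun i hi hne => hpos i ?_ hne) (hw _ le_rfl) h1
  by_contra hlt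
  exact hne (hw i (by omega))

/-- Otherwise the lower factor `L₁` would produce a nonzero entry of `T w` beyond the last nonzero
entry of `w`, where `T w = z w` vanishes. It follows that eigenspaces are at most one-dimensional.
-/
theorem IsPBF.last_ne_zero (h : IsPBF p q T L Δ U) (hp : 1 ≤ p) {n : ℕ} {w : ℕ → ℝ}
    (hw : ∀ i, n + 1 ≤ i → w i = 0) {z : ℝ} (hz : 0 < z)
    (hT : ∀ i < n + 1, act T (n + 1) w i = z * w i) (hne : ∃ i < n + 1, w i ≠ 0) : w n ≠ 0 := by
  have hpos : ∀ i < n + 1, w i ≠ 0 → 0 < w i * act T (n + 1) w i := by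
    intro i hi h0
    rw [hT i hi, mul_left_comm]
    exact mul_pos hz (mul_self_pos.2 h0)
  obtain ⟨i, hi, hwi⟩ := hne
  obtain ⟨m, hm, -, hwm, hmax⟩ := exists_last (P := fun i => w i ≠ 0) ⟨i, hi, Nat.zero_le i, hwi⟩
  by_contra h0
  have hmn : m ≠ n := by
    rintro rfl
    exact hwm h0
  obtain ⟨x, hx, hxy⟩ := h.chain_to_lower hp hw
  obtain ⟨j, hj, hmj, hyj⟩ := last_of_lower_chain hx hxy hpos (by omega) hwm
  refine hyj ?_
  rw [hT j hj, not_not.1 (hmax j (by omega) hj), mul_zero]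

/-- Back-substitution from the bottom entry: the inverse of a positive upper bidiagonal matrix has
checkerboard signs. Undoing a single factor already makes every sign strict, hence the condition `1
≤ c`. -/
theorem upperIter_alternates {U : ℕ → ℕ → ℝ} {N : ℕ} {w : ℕ → ℝ}
    (hw : ∀ i, N + 1 ≤ i → w i = 0) {c : ℕ} (hU : ∀ k, 1 ≤ k → k ≤ c → ∀ i, 0 < U k i) {σ : ℝ}
    (h0 : ∀ i < N, upperIter U c w i = 0) (hN : 0 < (-1) ^ N * σ * upperIter U c w N) :
    (∀ i ≤ N, 0 ≤ (-1) ^ i * σ * w i) ∧ 0 < (-1) ^ N * σ * w N ∧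
      (1 ≤ c → 0 < σ * w 0) := by
  have key : ∀ b ≤ c, (∀ i ≤ N, 0 ≤ (-1) ^ i * σ * upperIter U b w i) ∧
      0 < (-1) ^ N * σ * upperIter U b w N ∧ (b < c → 0 < σ * upperIter U b w 0) := by
    intro b hb
    induction hb using Nat.decreasingInduction with
    | self =>
      refine ⟨fun i hi => ?_, hN, fun h => absurd h (lt_irrefl _)⟩
      rcases hi.eq_or_lt with rfl | hi
      · exact hN.le
      · simp [h0 i hi]
    | of_succ b hb ih =>
      obtain ⟨h1, h2, -⟩ := ih
      have hs : ∀ j ≤ N, 0 < (-1) ^ (N - j) * σ * upperIter U b w (N - j) := by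
        intro j
        induction j with
        | zero =>
          intro _
          simpa [upperIter, upperAct, upperIter_supp U hw b (N + 1) le_rfl] using h2
        | succ j ih =>
          intro hj
          have h3 := ih (by omega)
          have h4 := h1 (N - (j + 1)) (by omega)
          have h5 := hU (b + 1) (by omega) hb (N - (j + 1))
          rw [show N - j = N - (j + 1) + 1 by omega, pow_succ] at h3
          simp only [upperIter, upperAct] at h4
          nlinarith [mul_pos h5 h3]
      refine ⟨fun i hi => ?_, by simpa using hs 0 (Nat.zero_le _),
        fun _ => by simpa using hs N le_rfl⟩
      have := hs (N - i) (by omega)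
      rw [show N - (N - i) = i by omega] at this
      exact this.le
  exact ⟨(key 0 (Nat.zero_le _)).1, (key 0 (Nat.zero_le _)).2.1,
    fun h => (key 0 (Nat.zero_le _)).2.2 (by omega)⟩

theorem eq_of_lowerFold {L : ℕ → ℕ → ℝ} {N : ℕ} (ks : List ℕ) (x : ℕ → ℝ)
    (h0 : ∀ i < N, lowerFold L ks x i = 0) : (∀ i < N, x i = 0) ∧ lowerFold L ks x N = x N := by
  induction ks with
  | nil => exact ⟨h0, rfl⟩
  | cons k ks ih =>
    have h1 : ∀ i < N, lowerFold L ks x i = 0 := by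
      intro i
      induction i with
      | zero =>
        intro hi
        simpa [lowerFold, lowerAct] using h0 0 hi
      | succ i ih =>
        intro hi
        have := h0 (i + 1) hi
        simp only [lowerFold, List.foldr_cons, lowerAct] at this ih ⊢
        simpa [ih (by omega)] using this
    refine ⟨(ih h1).1, ?_⟩
    rw [← (ih h1).2]
    rcases N with _ | N
    · simp [lowerFold, lowerAct]
    · have := h1 N (by omega)
      simp only [lowerFold, List.foldr_cons, lowerAct] at this ⊢
      simp [this]

/-- The last column of the inverse of a truncation starts with an entry of sign `(-1) ^ N`. -/
theorem IsPBF.first_pos_of_last (h : IsPBF p q T L Δ U) (hq : 1 ≤ q) {N : ℕ} {w : ℕ → ℝ}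
    (hw : ∀ i, N + 1 ≤ i → w i = 0) (h0 : ∀ i < N, act T (N + 1) w i = 0)
    (hN : 0 < (-1) ^ N * act T (N + 1) w N) : 0 < w 0 := by
  rw [h.act_eq hw] at h0 hN
  obtain ⟨h1, h2⟩ := eq_of_lowerFold _ _ h0
  rw [h2] at hN
  have h3 := upperIter_alternates (σ := 1) hw h.upper_pos (N := N) (fun i hi =>
    (mul_eq_zero.1 (h1 i hi)).resolve_left (h.diag_pos i).ne') (by
      rw [mul_left_comm] at hN
      simpa using pos_of_mul_pos_right hN (h.diag_pos N).le)
  simpa using h3.2.2 hq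

/-- The outermost entry is one product of positive subdiagonal entries with `x n`, so no
cancellation can occur. -/
theorem lowerFold_band {L : ℕ → ℕ → ℝ} {n : ℕ} (ks : List ℕ)
    (hL : ∀ k ∈ ks, ∀ i, 0 < L (k + 1) i) {x : ℕ → ℝ} (h0 : ∀ i, n < i → x i = 0)
    (hn : 0 < x n) : (∀ i, n + ks.length < i → lowerFold L ks x i = 0) ∧
      0 < lowerFold L ks x (n + ks.length) := by
  induction ks with
  | nil => exact ⟨h0, hn⟩
  | cons k ks ih =>
    obtain ⟨h1, h2⟩ := ih fun k hk => hL k (List.mem_cons_of_mem _ hk)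
    have hk := hL k List.mem_cons_self
    have heq : lowerFold L (k :: ks) x = lowerAct (L (k + 1)) (lowerFold L ks x) := rfl
    rw [heq, List.length_cons]
    constructor
    · intro i hi
      simp [lowerAct, h1 i (by omega), h1 (i - 1) (by omega)]
    · simp only [lowerAct, ← add_assoc]
      simp [h1 (n + ks.length + 1) (by omega), mul_pos (hk _) h2]

theorem act_single (M : Matrix ℕ ℕ ℝ) (j : ℕ) :
    act M (j + 1) (Pi.single j 1) = fun i => M i j := by
  funext i
  simp [act, Pi.single_apply]

theorem IsPBF.band (h : IsPBF p q T L Δ U) (n : ℕ) :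
    (∀ i, n + p < i → T i n = 0) ∧ 0 < T (n + p) n := by
  have hw : ∀ i, n + 1 ≤ i → (Pi.single n 1 : ℕ → ℝ) i = 0 := by
    intro i hi
    simp [Pi.single_apply]
    omega
  have h1 := h.act_eq hw
  rw [act_single] at h1
  have h2 : ∀ c, upperIter U c (Pi.single n 1) n = 1 := by
    intro c
    induction c with
    | zero => simp [upperIter]
    | succ c ih => simp [upperIter, upperAct, ih, upperIter_supp U hw c (n + 1) le_rfl]
  have h3 := lowerFold_band (n := n) (x := fun i => Δ i * upperIter U q (Pi.single n 1) i)
    (List.range p) h.lower_mem (fun i hi => by simp [upperIter_supp U hw q i hi])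
    (by simpa [h2] using h.diag_pos n)
  rw [← h1, List.length_range] at h3
  exact h3

end

/-! ### Truncations, transposition and determinants. -/

/-- The condition holds for a lower triangular left factor and for an upper triangular right factor:
no path leaves the leading block and returns. -/
theorem trunc_infMul {n : ℕ} {F K : Matrix ℕ ℕ ℝ}
    (h : ∀ i < n, ∀ j < n, ∀ k, n ≤ k → F i k * K k j = 0) :
    trunc n (infMul F K) = trunc n F * trunc n K := by
  ext i j
  rw [Matrix.mul_apply]
  change infMul F K i j = ∑ k : Fin n, F i k * K k j
  rw [infMul_eq_sum (Finset.range n), Finset.sum_range]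
  intro k hk
  exact h i i.2 j j.2 k (by simpa using hk)

theorem trunc_infProd_lower {n : ℕ} (ls : List (Matrix ℕ ℕ ℝ))
    (h : ∀ F ∈ ls, ∀ i j, i < j → F i j = 0) (K : Matrix ℕ ℕ ℝ) :
    trunc n (ls.foldr infMul K) = (ls.map (trunc n)).prod * trunc n K := by
  induction ls with
  | nil => simp
  | cons F ls ih =>
    rw [List.foldr_cons, trunc_infMul, ih fun G hG => h G (List.mem_cons_of_mem _ hG),
      List.map_cons, List.prod_cons, mul_assoc]
    intro i hi j _ k hk
    rw [h F List.mem_cons_self i k (by omega), zero_mul]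

theorem trunc_one (n : ℕ) : trunc n 1 = 1 := by
  ext i j
  simp [trunc, Matrix.one_apply, Fin.ext_iff]

theorem trunc_infProd_upper {n : ℕ} (ls : List (Matrix ℕ ℕ ℝ))
    (h : ∀ F ∈ ls, ∃ u, F = upperBidiag u) :
    trunc n (infProd ls) = (ls.map (trunc n)).prod ∧ ∀ i j, j < i → infProd ls i j = 0 := by
  induction ls with
  | nil =>
    refine ⟨by simp [infProd, trunc_one], fun i j hij => ?_⟩
    simp [infProd, hij.ne']
  | cons F ls ih =>
    obtain ⟨h1, h2⟩ := ih fun G hG => h G (List.mem_cons_of_mem _ hG)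
    have heq : infProd (F :: ls) = infMul F (infProd ls) := rfl
    rw [heq, trunc_infMul, h1, List.map_cons, List.prod_cons]
    · refine ⟨rfl, fun i j hij => ?_⟩
      obtain ⟨u, rfl⟩ := h F List.mem_cons_self
      rw [infMul_upperBidiag]
      simp [upperAct, h2 i j hij, h2 (i + 1) j (by omega)]
    · intro i _ j hj k hk
      rw [h2 k j (by omega), mul_zero]

theorem trunc_bidiag_prod (n p q : ℕ) (L : ℕ → ℕ → ℝ) (Δ : ℕ → ℝ) (U : ℕ → ℕ → ℝ) :
    trunc n (infProd ((List.range p).map (fun k => lowerBidiag (L (k + 1))) ++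
      [Matrix.diagonal Δ] ++ (List.range q).reverse.map (fun k => upperBidiag (U (k + 1))))) =
    ((List.range p).map fun k => trunc n (lowerBidiag (L (k + 1)))).prod *
      (trunc n (Matrix.diagonal Δ) *
      ((List.range q).reverse.map fun k => trunc n (upperBidiag (U (k + 1)))).prod) := by
  rw [infProd, List.foldr_append, List.foldr_append, trunc_infProd_lower, List.foldr_cons,
    List.foldr_nil, trunc_infMul]
  · change _ * (_ * trunc n (infProd _)) = _
    rw [(trunc_infProd_upper _ _).1, List.map_map, List.map_map]
    · rfl
    · intro F hF
      obtain ⟨k, -, rfl⟩ := List.mem_map.1 hF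
      exact ⟨_, rfl⟩
  · intro i hi j _ k hk
    rw [Matrix.diagonal_apply_ne _ (by omega), zero_mul]
  · intro F hF i j hij
    obtain ⟨k, -, rfl⟩ := List.mem_map.1 hF
    simp only [lowerBidiag, Matrix.of_apply]
    rw [if_neg (by omega), if_neg (by omega)]

theorem transpose_lowerBidiag (l : ℕ → ℝ) : (lowerBidiag l)ᵀ = upperBidiag l := by
  ext i j
  simp only [lowerBidiag, upperBidiag, Matrix.transpose_apply, Matrix.of_apply, eq_comm]

theorem transpose_upperBidiag (l : ℕ → ℝ) : (upperBidiag l)ᵀ = lowerBidiag l := by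
  rw [← transpose_lowerBidiag, Matrix.transpose_transpose]

theorem trunc_transpose (n : ℕ) (M : Matrix ℕ ℕ ℝ) : trunc n Mᵀ = (trunc n M)ᵀ := rfl

theorem ext_trunc {M K : Matrix ℕ ℕ ℝ} (h : ∀ n, trunc n M = trunc n K) : M = K := by
  ext i j
  have := congrFun (congrFun (h (max i j + 1)) ⟨i, by omega⟩) ⟨j, by omega⟩
  exact this

section
variable {p q : ℕ} {T : Matrix ℕ ℕ ℝ} {L : ℕ → ℕ → ℝ} {Δ : ℕ → ℝ} {U : ℕ → ℕ → ℝ}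

/-- Finite truncations determine `T`, and for them transposition reverses products. Facts on right
eigenvectors thus pass to left ones, with `L` and `U` exchanged. -/
theorem IsPBF.transpose (h : IsPBF p q T L Δ U) : IsPBF q p Tᵀ U Δ L := by
  refine ⟨ext_trunc fun n => ?_, h.upper_pos, h.diag_pos, h.lower_pos⟩
  rw [trunc_bidiag_prod, trunc_transpose, h.eq_prod, trunc_bidiag_prod, Matrix.transpose_mul,
    Matrix.transpose_mul, Matrix.transpose_list_prod, Matrix.transpose_list_prod, mul_assoc,
    ← trunc_transpose, Matrix.diagonal_transpose]
  simp only [List.map_map, List.map_reverse, List.reverse_reverse, Function.comp_def,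
    ← trunc_transpose, transpose_lowerBidiag, transpose_upperBidiag]

theorem IsPBF.det_pos (h : IsPBF p q T L Δ U) (n : ℕ) : 0 < (trunc n T).det := by
  have hlow : ∀ l, (trunc n (lowerBidiag l)).det = 1 := by
    intro l
    rw [Matrix.det_of_isLowerTriangular]
    · simp [trunc, lowerBidiag]
    · intro i j hij
      have : (i : ℕ) < j := hij
      simp only [trunc, lowerBidiag, Matrix.submatrix_apply, Matrix.of_apply]
      rw [if_neg (by omega), if_neg (by omega)]
  have hup : ∀ u, (trunc n (upperBidiag u)).det = 1 := by
    intro u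
    rw [← transpose_lowerBidiag, trunc_transpose, Matrix.det_transpose, hlow]
  have hprod : ∀ ls : List (Matrix (Fin n) (Fin n) ℝ), (∀ F ∈ ls, F.det = 1) → ls.prod.det = 1 := by
    intro ls hls
    induction ls with
    | nil => simp
    | cons F ls ih =>
      rw [List.prod_cons, Matrix.det_mul, hls F List.mem_cons_self,
        ih fun G hG => hls G (List.mem_cons_of_mem _ hG), one_mul]
  have hd : (trunc n (Matrix.diagonal Δ)).det = ∏ i : Fin n, Δ i := by
    rw [trunc, Matrix.submatrix_diagonal _ _ Fin.val_injective, Matrix.det_diagonal]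
    rfl
  rw [h.eq_prod, trunc_bidiag_prod, Matrix.det_mul, Matrix.det_mul, hd, hprod, hprod, one_mul,
    mul_one]
  · exact Finset.prod_pos fun i _ => h.diag_pos i
  · intro F hF
    obtain ⟨k, -, rfl⟩ := List.mem_map.1 hF
    exact hup _
  · intro F hF
    obtain ⟨k, -, rfl⟩ := List.mem_map.1 hF
    exact hlow _

end

/-- Each upper factor reads one index further to the right, so the entries with `i + c < m` do not
feel the truncation. -/
theorem trunc_upper_prod_mulVec (U : ℕ → ℕ → ℝ) (m : ℕ) (w : ℕ → ℝ) (c : ℕ) (i : Fin m)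
    (hi : i + c < m) :
    (((List.range c).reverse.map fun k => trunc m (upperBidiag (U (k + 1)))).prod *ᵥ
      fun j : Fin m => w j) i = upperIter U c w i := by
  induction c generalizing i with
  | zero => simp [upperIter]
  | succ c ih =>
    rw [List.range_succ, List.reverse_append]
    simp only [List.reverse_singleton, List.singleton_append, List.map_cons, List.prod_cons]
    rw [← Matrix.mulVec_mulVec, Matrix.mulVec, dotProduct,
      Fintype.sum_eq_add i (⟨i + 1, by omega⟩ : Fin m) (by simp [Fin.ext_iff]), ih i (by omega),
      ih ⟨i + 1, by omega⟩ (by simp only; omega)]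
    · simp [trunc, upperBidiag, upperIter, upperAct]
    · rintro j ⟨hj, hj'⟩
      have h1 : (i : ℕ) ≠ j := fun h => hj (Fin.ext h.symm)
      have h2 : (j : ℕ) ≠ i + 1 := fun h => hj' (Fin.ext h)
      simp [trunc, upperBidiag, h1, h2]

theorem upsilonMat_mulVec (q : ℕ) (U : ℕ → ℕ → ℝ) (w : ℕ → ℝ) (c : Fin q) :
    (upsilonMat q U *ᵥ fun j : Fin q => w j) c =
      (∏ i ∈ Finset.range c, U (c - i) i)⁻¹ * upperIter U c w 0 := by
  have hq : 0 < q := c.pos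
  have h := trunc_upper_prod_mulVec U q w c ⟨0, hq⟩ (by simp)
  have hf : firstVec q = Pi.single ⟨0, hq⟩ 1 := by
    funext i
    simp [firstVec, Pi.single_apply, Fin.ext_iff]
  rw [Matrix.mulVec, dotProduct] at h ⊢
  rw [← h, Finset.mul_sum]
  refine Finset.sum_congr rfl fun j _ => ?_
  rw [upsilonMat, Matrix.of_apply, mul_assoc, hf, Matrix.single_one_vecMul]
  rfl

theorem lambdaMat_eq (p : ℕ) (L : ℕ → ℕ → ℝ) : lambdaMat p L = (upsilonMat p L)ᵀ := by
  ext i c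
  rw [lambdaMat, upsilonMat, Matrix.transpose_apply, Matrix.of_apply, Matrix.of_apply,
    ← Matrix.vecMul_transpose, Matrix.transpose_list_prod]
  simp only [List.map_map, List.map_reverse, Function.comp_def, ← trunc_transpose,
    transpose_lowerBidiag]

/-! ### The last column of the adjugate and the Sturm property. -/

/-- The last column of the adjugate of `X - T`, for the truncation of `T` with indices `0, …, N`,
extended by zero. -/
def adjCol (T : Matrix ℕ ℕ ℝ) (N n : ℕ) : ℝ[X] :=
  if h : n < N + 1 then (charmatrix (trunc (N + 1) T)).adjugate ⟨n, h⟩ (Fin.last N) else 0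

/-- The values of `adjCol` at `x`. -/
def adjVec (T : Matrix ℕ ℕ ℝ) (N : ℕ) (x : ℝ) (n : ℕ) : ℝ := (adjCol T N n).eval x

theorem adjCol_fin (T : Matrix ℕ ℕ ℝ) (N : ℕ) (n : Fin (N + 1)) :
    adjCol T N n = (charmatrix (trunc (N + 1) T)).adjugate n (Fin.last N) := by
  rw [adjCol, dif_pos n.2]

theorem adjCol_supp (T : Matrix ℕ ℕ ℝ) (N : ℕ) {n : ℕ} (h : N + 1 ≤ n) : adjCol T N n = 0 :=
  dif_neg (by omega)

theorem adjCol_transpose_fin (T : Matrix ℕ ℕ ℝ) (N : ℕ) (n : Fin (N + 1)) :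
    adjCol Tᵀ N n = (charmatrix (trunc (N + 1) T)).adjugate (Fin.last N) n := by
  rw [adjCol_fin, trunc_transpose, charmatrix_transpose, ← adjugate_transpose, transpose_apply]

theorem charpoly_trunc_transpose (T : Matrix ℕ ℕ ℝ) (N : ℕ) :
    (trunc N Tᵀ).charpoly = (trunc N T).charpoly := by
  rw [trunc_transpose, charpoly_transpose]

theorem adjCol_last (T : Matrix ℕ ℕ ℝ) (N : ℕ) : adjCol T N N = (trunc N T).charpoly := by
  have := adjCol_fin T N (Fin.last N)
  rw [Fin.val_last] at this
  rw [this, adjugate_fin_succ_eq_det_submatrix, Fin.succAbove_last, charpoly]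
  have h : (charmatrix (trunc (N + 1) T)).submatrix Fin.castSucc Fin.castSucc =
      charmatrix (trunc N T) := by
    ext1 i j
    simp [charmatrix_apply, trunc, diagonal_apply]
  rw [h, ← two_mul, pow_mul]
  simp

theorem charmatrix_mulVec_adjCol (T : Matrix ℕ ℕ ℝ) (N : ℕ) :
    (charmatrix (trunc (N + 1) T)) *ᵥ (fun j : Fin (N + 1) => adjCol T N j) =
      Pi.single (Fin.last N) (trunc (N + 1) T).charpoly := by
  funext i
  have h := congrFun (congrFun (mul_adjugate (charmatrix (trunc (N + 1) T))) i) (Fin.last N)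
  rw [Matrix.mul_apply] at h
  rw [mulVec, dotProduct]
  simp only [adjCol_fin]
  rw [h, charpoly]
  simp [Matrix.one_apply, Pi.single_apply]

theorem charmatrix_mulVec (T : Matrix ℕ ℕ ℝ) (n : ℕ) (w : ℕ → ℝ[X]) (i : Fin n) :
    ((charmatrix (trunc n T)) *ᵥ fun j : Fin n => w j) i =
      X * w i - ∑ j ∈ Finset.range n, C (T i j) * w j := by
  rw [charmatrix, sub_mulVec, Pi.sub_apply, scalar_apply, mulVec_diagonal, Finset.sum_range]
  rfl

theorem sum_mul_adjCol (T : Matrix ℕ ℕ ℝ) {N i : ℕ} (hi : i ≤ N) :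
    ∑ j ∈ Finset.range (N + 1), C (T i j) * adjCol T N j =
      X * adjCol T N i - if i = N then (trunc (N + 1) T).charpoly else 0 := by
  have h := congrFun (charmatrix_mulVec_adjCol T N) ⟨i, by omega⟩
  rw [charmatrix_mulVec] at h
  simp only [Pi.single_apply, Fin.ext_iff, Fin.val_last] at h
  rw [← h]
  ring

theorem eq_adjugate_mulVec {n : ℕ} {M : Matrix (Fin n) (Fin n) ℝ} {w c : Fin n → ℝ[X]} {g : ℝ[X]}
    (h : charmatrix M *ᵥ w = g • c) : M.charpoly • w = g • ((charmatrix M).adjugate *ᵥ c) := by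
  rw [← mulVec_smul, ← h, mulVec_mulVec, adjugate_mul, smul_mulVec, one_mulVec, charpoly]

/-- The first `N + 1` rows of the adjugate equation of size `N + 2` are a system with matrix `X -
T^{[N]}` and right side a column of `T` times its characteristic polynomial. Applying the smaller
adjugate and cancelling that polynomial leaves the last row of the smaller adjugate. -/
theorem adjCol_succ (T : Matrix ℕ ℕ ℝ) (N : ℕ) :
    adjCol T (N + 1) N = ∑ l ∈ Finset.range (N + 1), C (Tᵀ (N + 1) l) * adjCol Tᵀ N l := by
  have h1 : charmatrix (trunc (N + 1) T) *ᵥ (fun j : Fin (N + 1) => adjCol T (N + 1) j) =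
      (trunc (N + 1) T).charpoly • fun i : Fin (N + 1) => C (T i (N + 1)) := by
    funext i
    have h := sum_mul_adjCol T (N := N + 1) (i := i) (by omega)
    rw [Finset.sum_range_succ, if_neg (by omega), adjCol_last, sub_zero] at h
    rw [charmatrix_mulVec, Pi.smul_apply, smul_eq_mul, ← h]
    ring
  have h2 := congrFun (eq_adjugate_mulVec h1) (Fin.last N)
  have h3 := mul_left_cancel₀ (charpoly_monic (trunc (N + 1) T)).ne_zero h2
  change adjCol T (N + 1) N = _ at h3
  rw [h3, mulVec, dotProduct, Finset.sum_range]
  refine Finset.sum_congr rfl fun l _ => ?_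
  rw [adjCol_transpose_fin, mul_comm, transpose_apply]

theorem adjVec_supp (T : Matrix ℕ ℕ ℝ) (N : ℕ) (x : ℝ) : ∀ n, N + 1 ≤ n → adjVec T N x n = 0 :=
  fun n h => by rw [adjVec, adjCol_supp T N h, eval_zero]

theorem adjVec_last (T : Matrix ℕ ℕ ℝ) (N : ℕ) (x : ℝ) :
    adjVec T N x N = (trunc N T).charpoly.eval x := by
  rw [adjVec, adjCol_last]

theorem act_adjVec (T : Matrix ℕ ℕ ℝ) {N i : ℕ} (hi : i ≤ N) (x : ℝ) :
    act T (N + 1) (adjVec T N x) i =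
      x * adjVec T N x i - if i = N then (trunc (N + 1) T).charpoly.eval x else 0 := by
  have h := congrArg (eval x) (sum_mul_adjCol T hi)
  simp only [eval_finsetSum, eval_mul, eval_C, eval_sub, eval_X] at h
  rw [act]
  simp only [adjVec, h]
  split_ifs <;> simp

theorem act_succ_of_eq_zero (T : Matrix ℕ ℕ ℝ) {n : ℕ} {w : ℕ → ℝ} (h : w n = 0) :
    act T (n + 1) w = act T n w := by
  funext i
  simp [act, Finset.sum_range_succ, h]

theorem det_eq_eval_charpoly (T : Matrix ℕ ℕ ℝ) (n : ℕ) :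
    (-1) ^ n * (trunc n T).charpoly.eval 0 = (trunc n T).det := by
  rw [det_eq_sign_charpoly_coeff, Fintype.card_fin, coeff_zero_eq_eval_zero]

theorem natDegree_charpoly_trunc (T : Matrix ℕ ℕ ℝ) (n : ℕ) :
    (trunc n T).charpoly.natDegree = n := by
  rw [charpoly_natDegree_eq_dim, Fintype.card_fin]

section
variable {p q : ℕ} {T : Matrix ℕ ℕ ℝ} {L : ℕ → ℕ → ℝ} {Δ : ℕ → ℝ} {U : ℕ → ℕ → ℝ}

theorem eigen_sign {T : Matrix ℕ ℕ ℝ} {n m : ℕ} {w : ℕ → ℝ} {z : ℝ} (hz : 0 < z)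
    (h : ∀ i < n, act T m w i = z * w i) : ∀ i < n, w i ≠ 0 → 0 < w i * act T m w i := by
  intro i hi h0
  rw [h i hi, mul_left_comm]
  exact mul_pos hz (mul_self_pos.2 h0)

/-- At a zero `z` of a characteristic polynomial, the entries of `adjVec` satisfy the eigenvalue
equation of the truncation smaller by one. -/
theorem act_adjVec_root (T : Matrix ℕ ℕ ℝ) {N : ℕ} {z : ℝ}
    (hz : (trunc (N + 1) T).charpoly.eval z = 0) :
    (∀ i, N + 1 ≤ i → adjVec T (N + 1) z i = 0) ∧
    (∀ i < N + 1, act T (N + 1) (adjVec T (N + 1) z) i = z * adjVec T (N + 1) z i) ∧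
    act T (N + 1) (adjVec T (N + 1) z) (N + 1) = -(trunc (N + 2) T).charpoly.eval z := by
  have h0 : adjVec T (N + 1) z (N + 1) = 0 := by rw [adjVec_last, hz]
  refine ⟨fun i hi => ?_, fun i hi => ?_, ?_⟩
  · rcases hi.eq_or_lt with rfl | hi
    · exact h0
    · exact adjVec_supp _ _ _ _ hi
  · rw [← act_succ_of_eq_zero T h0, act_adjVec T hi.le, if_neg hi.ne, sub_zero]
  · rw [← act_succ_of_eq_zero T h0, act_adjVec T le_rfl, if_pos rfl, h0, mul_zero, zero_sub]

/-- For the truncation of size `N + 1` at `z`, `adjVec Tᵀ N z` is a left and `adjVec T (N + 1) z` a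
right eigenvector. By `IsPBF.last_mul_pos` the next row keeps the sign of the last entry: for the
first vector it gives entry `N` of the second one (`adjCol_succ`), for the second it gives minus the
next characteristic polynomial. -/
theorem IsPBF.sturm (h : IsPBF p q T L Δ U) (hp : 1 ≤ p) (hq : 1 ≤ q) {N : ℕ} {z : ℝ} (hz0 : 0 < z)
    (hz : (trunc (N + 1) T).charpoly.eval z = 0) (hne : (trunc N T).charpoly.eval z ≠ 0) :
    0 < (trunc N T).charpoly.eval z * adjVec T (N + 1) z N ∧
      (trunc N T).charpoly.eval z * (trunc (N + 2) T).charpoly.eval z < 0 := by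
  have hv : ∀ i < N + 1, act Tᵀ (N + 1) (adjVec Tᵀ N z) i = z * adjVec Tᵀ N z i := by
    intro i hi
    rw [act_adjVec _ (by omega), charpoly_trunc_transpose, hz, ite_self, sub_zero]
  have h1 := h.transpose.last_mul_pos hq (adjVec_supp _ _ _) (eigen_sign hz0 hv)
    (by rwa [adjVec_last, charpoly_trunc_transpose])
  have h2 : act Tᵀ (N + 1) (adjVec Tᵀ N z) (N + 1) = adjVec T (N + 1) z N := by
    rw [adjVec, adjCol_succ, eval_finsetSum, act]
    simp only [eval_mul, eval_C, adjVec]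
  rw [h2, adjVec_last, charpoly_trunc_transpose] at h1
  obtain ⟨hw0, hw1, hw2⟩ := act_adjVec_root T hz
  have h3 := h.last_mul_pos hp hw0 (eigen_sign hz0 hw1) (right_ne_zero_of_mul h1.ne')
  rw [hw2] at h3
  refine ⟨h1, ?_⟩
  have h4 := mul_pos h1 h3
  have h5 : 0 < adjVec T (N + 1) z N ^ 2 * -((trunc N T).charpoly.eval z *
      (trunc (N + 2) T).charpoly.eval z) := by nlinarith
  have := pos_of_mul_pos_right h5 (sq_nonneg _)
  linarith

/-- At a zero of the preceding characteristic polynomial the first entries of two consecutive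
vectors `adjVec` have the same sign. -/
theorem IsPBF.adjVec_root_pos (h : IsPBF p q T L Δ U) (hp : 1 ≤ p) (hq : 1 ≤ q) {N : ℕ} {z : ℝ}
    (hz0 : 0 < z) (hz : (trunc (N + 1) T).charpoly.eval z = 0)
    (hne : (trunc N T).charpoly.eval z ≠ 0) (hpos : 0 < adjVec T N z 0) :
    0 < adjVec T (N + 1) z 0 := by
  obtain ⟨h1, -⟩ := h.sturm hp hq hz0 hz hne
  obtain ⟨hw0, hw1, -⟩ := act_adjVec_root T hz
  set c := (trunc N T).charpoly.eval z
  -- The combination of the two eigenvectors that kills entry `N` is zero, so they are proportional;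
  -- `h1` makes the factor positive.
  have hd : c * adjVec T (N + 1) z 0 - adjVec T (N + 1) z N * adjVec T N z 0 = 0 := by
    by_contra hd0
    refine h.last_ne_zero hp
      (w := fun i => c * adjVec T (N + 1) z i - adjVec T (N + 1) z N * adjVec T N z i)
      (n := N) (fun i hi => ?_) hz0 (fun i hi => ?_) ⟨0, by omega, hd0⟩ ?_
    · simp [hw0 i hi, adjVec_supp T N z i hi]
    · have h2 := hw1 i hi
      have h3 := act_adjVec T (N := N) (i := i) (by omega) z
      rw [hz, ite_self, sub_zero] at h3
      rw [mul_sub, mul_left_comm, mul_left_comm z, ← h2, ← h3]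
      simp only [act, Finset.mul_sum, ← Finset.sum_sub_distrib]
      exact Finset.sum_congr rfl fun j _ => by ring
    · rw [adjVec_last]
      exact sub_eq_zero.2 (mul_comm _ _)
  have h2 : 0 < c ^ 2 * adjVec T (N + 1) z 0 := by
    calc _ < c * adjVec T (N + 1) z N * adjVec T N z 0 := mul_pos h1 hpos
      _ = _ := by linear_combination -c * hd
  exact pos_of_mul_pos_right h2 (sq_nonneg _)

end

/-! ### Real-rooted polynomials and their signs. -/

theorem exists_interlacing_roots {P : ℝ[X]} (hP : P.Monic) {m : ℕ} (hm : P.natDegree = m)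
    {e : ℕ → ℝ} (he : ∀ k < m, e (k + 1) < e k) (hs : ∀ k ≤ m, 0 < (-1) ^ k * P.eval (e k)) :
    ∃ r : ℕ → ℝ, (∀ k < m, e (k + 1) < r k ∧ r k < e k) ∧
      P = ∏ k ∈ Finset.range m, (X - C (r k)) := by
  have hroot : ∀ k, ∃ x, k < m → (e (k + 1) < x ∧ x < e k) ∧ P.IsRoot x := by
    intro k
    by_cases hk : k < m
    · have h1 := hs k hk.le
      have h2 := hs (k + 1) hk
      rw [pow_succ] at h2
      have hc : ContinuousOn (fun x => (-1) ^ k * P.eval x) (Set.Icc (e (k + 1)) (e k)) := by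
        fun_prop
      obtain ⟨x, ⟨hx1, hx2⟩, hx⟩ := intermediate_value_Ioo (he k hk).le hc
        (show (0 : ℝ) ∈ Set.Ioo _ _ from ⟨by linarith, h1⟩)
      exact ⟨x, fun _ => ⟨⟨hx1, hx2⟩, (mul_eq_zero.1 hx).resolve_left (by simp)⟩⟩
    · exact ⟨0, fun h => absurd h hk⟩
  choose r hr using hroot
  refine ⟨r, fun k hk => (hr k hk).1, ?_⟩
  have hanti : ∀ j k, j < k → k < m → r k < r j := by
    intro j k hjk hk
    have : ∀ i, j + 1 ≤ i → i ≤ m → e i ≤ e (j + 1) := by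
      intro i hi
      induction i, hi using Nat.le_induction with
      | base => exact fun _ => le_rfl
      | succ i hi ih => exact fun h => (he i h).le.trans (ih (by omega))
    have h1 := (hr k hk).1.2
    have h2 := (hr j (by omega)).1.1
    linarith [this k hjk hk.le]
  have hdvd : ∏ k ∈ Finset.range m, (X - C (r k)) ∣ P := by
    refine Finset.prod_dvd_of_coprime (fun j hj k hk hjk => ?_) fun k hk =>
      dvd_iff_isRoot.2 (hr k (Finset.mem_range.1 hk)).2
    simp only [Finset.coe_range, Set.mem_Iio] at hj hk
    refine isCoprime_X_sub_C_of_isUnit_sub (sub_ne_zero.2 ?_).isUnit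
    rcases lt_or_gt_of_ne hjk with h | h
    · exact (hanti j k h hk).ne'
    · exact (hanti k j h hj).ne
  refine (eq_of_monic_of_dvd_of_natDegree_le (monic_prod_of_monic _ _ fun k _ => monic_X_sub_C _) hP
    hdvd ?_)
  rw [hm, natDegree_prod_of_monic _ _ fun k _ => monic_X_sub_C _]
  simp

theorem neg_one_pow_mul_eval_prod {n m : ℕ} (hmn : m ≤ n) (r : ℕ → ℝ) (x : ℝ) :
    (-1) ^ m * (∏ k ∈ Finset.range n, (X - C (r k))).eval x =
      (∏ k ∈ Finset.range m, (r k - x)) * ∏ k ∈ Finset.Ico m n, (x - r k) := by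
  rw [eval_prod, ← Finset.prod_range_mul_prod_Ico _ hmn, ← mul_assoc]
  congr 1
  · rw [← Finset.card_range m, ← Finset.prod_const, Finset.card_range, ← Finset.prod_mul_distrib]
    exact Finset.prod_congr rfl fun k _ => by simp
  · exact Finset.prod_congr rfl fun k _ => by simp

theorem neg_one_pow_mul_eval_prod_pos {n m : ℕ} (hmn : m ≤ n) {r : ℕ → ℝ} {x : ℝ}
    (h1 : ∀ k < m, x < r k) (h2 : ∀ k, m ≤ k → k < n → r k < x) :
    0 < (-1) ^ m * (∏ k ∈ Finset.range n, (X - C (r k))).eval x := by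
  rw [neg_one_pow_mul_eval_prod hmn]
  refine mul_pos (Finset.prod_pos fun k hk => sub_pos.2 (h1 k (Finset.mem_range.1 hk)))
    (Finset.prod_pos fun k hk => ?_)
  rw [Finset.mem_Ico] at hk
  exact sub_pos.2 (h2 k hk.1 hk.2)

theorem neg_one_pow_mul_eval_prod_nonneg {n m : ℕ} (hmn : m ≤ n) {r : ℕ → ℝ} {x : ℝ}
    (h1 : ∀ k < m, x ≤ r k) (h2 : ∀ k, m ≤ k → k < n → r k ≤ x) :
    0 ≤ (-1) ^ m * (∏ k ∈ Finset.range n, (X - C (r k))).eval x := by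
  rw [neg_one_pow_mul_eval_prod hmn]
  refine mul_nonneg (Finset.prod_nonneg fun k hk => sub_nonneg.2 (h1 k (Finset.mem_range.1 hk)))
    (Finset.prod_nonneg fun k hk => ?_)
  rw [Finset.mem_Ico] at hk
  exact sub_nonneg.2 (h2 k hk.1 hk.2)

theorem exists_eval_pos {P : ℝ[X]} (hP : P.Monic) (hd : 0 < P.natDegree) (a : ℝ) :
    ∃ b, a < b ∧ 0 < P.eval b := by
  have h := P.tendsto_atTop_of_leadingCoeff_nonneg (natDegree_pos_iff_degree_pos.1 hd)
    (by rw [hP.leadingCoeff]; exact zero_le_one)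
  obtain ⟨b, hb, hb'⟩ := ((h.eventually_gt_atTop 0).and (Filter.eventually_gt_atTop a)).exists
  exact ⟨b, hb', hb⟩

theorem antitone_of_succ_lt {r : ℕ → ℝ} {n : ℕ} (h : ∀ k, k + 1 < n → r (k + 1) < r k) {j k : ℕ}
    (hjk : j ≤ k) (hk : k < n) : r k ≤ r j := by
  induction k, hjk using Nat.le_induction with
  | base => exact le_rfl
  | succ k _ ih => exact (h k hk).le.trans (ih (by omega))

/-! ### Interlacing spectra and positive first entries. -/

section
variable {p q : ℕ} {T : Matrix ℕ ℕ ℝ} {L : ℕ → ℕ → ℝ} {Δ : ℕ → ℝ} {U : ℕ → ℕ → ℝ}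

theorem IsPBF.adjVec_zero_pos (h : IsPBF p q T L Δ U) (hq : 1 ≤ q) (N : ℕ) :
    0 < adjVec T N 0 0 := by
  refine h.first_pos_of_last hq (adjVec_supp T N 0) (fun i hi => ?_) ?_
  · rw [act_adjVec T hi.le, if_neg hi.ne]
    simp
  · rw [act_adjVec T le_rfl, if_pos rfl]
    have := det_eq_eval_charpoly T (N + 1)
    rw [pow_succ] at this
    linarith [h.det_pos (N + 1)]

/-- The first entry of `adjVec` does not vanish between a zero of the smaller characteristic
polynomial and the next zero of the larger one. -/
theorem IsPBF.adjVec_ne_zero (h : IsPBF p q T L Δ U) (hq : 1 ≤ q) {N k : ℕ} {x : ℝ} (hx : 0 < x)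
    (h1 : 0 < (-1) ^ k * (trunc N T).charpoly.eval x)
    (h2 : 0 ≤ (-1) ^ (k + 1) * (trunc (N + 1) T).charpoly.eval x) : adjVec T N x 0 ≠ 0 := by
  have hN : adjVec T N x N ≠ 0 := by
    rw [adjVec_last]
    exact right_ne_zero_of_mul h1.ne'
  have hact : ∀ i < N, act T (N + 1) (adjVec T N x) i = x * adjVec T N x i := by
    intro i hi
    rw [act_adjVec T hi.le, if_neg hi.ne, sub_zero]
  refine h.first_ne_zero hq (adjVec_supp T N x) (fun i hi h0 => ?_)
    (fun i hi h0 => by rw [hact i (by omega), h0, mul_zero]) ⟨N, by omega, hN⟩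
  -- Only the last row deviates from the eigenvalue equation. The deviation `-b` has the sign of the
  -- last entry `a` or is zero, so signs are still preserved.
  rcases (Nat.lt_succ_iff.1 hi).eq_or_lt with rfl | hi
  · rw [act_adjVec T le_rfl, if_pos rfl, adjVec_last]
    rw [pow_succ] at h2
    set a := (trunc i T).charpoly.eval x
    set b := (trunc (i + 1) T).charpoly.eval x
    have h3 : ((-1 : ℝ) ^ k) ^ 2 = 1 := by rw [← pow_mul, mul_comm, pow_mul]; simp
    have h4 : a * (x * a - b) = x * ((-1) ^ k * a) ^ 2 + ((-1) ^ k * a) * ((-1) ^ k * -1 * b) := by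
      linear_combination (a * b - x * a ^ 2) * h3
    rw [h4]
    have := mul_pos hx (pow_pos h1 2)
    have := mul_nonneg h1.le h2
    linarith
  · exact eigen_sign hx hact i hi h0

/-- The eigenvalues of the truncations are positive and simple and interlace strictly, and the
vectors `adjVec` start with a positive entry at the eigenvalues. -/
theorem IsPBF.spectrum (h : IsPBF p q T L Δ U) (hp : 1 ≤ p) (hq : 1 ≤ q) (N : ℕ) :
    ∃ r : ℕ → ℝ, (∀ k, k + 1 < N + 1 → r (k + 1) < r k) ∧ (∀ k < N + 1, 0 < r k) ∧
      (trunc (N + 1) T).charpoly = ∏ k ∈ Finset.range (N + 1), (X - C (r k)) ∧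
      ∀ k < N + 1, 0 < (-1) ^ k * (trunc N T).charpoly.eval (r k) ∧ 0 < adjVec T N (r k) 0 := by
  induction N with
  | zero =>
    refine ⟨fun _ => T 0 0, by omega, fun _ _ => ?_, ?_, fun k hk => ?_⟩
    · have := h.det_pos 1
      rw [det_fin_one] at this
      exact this
    · simp [charpoly, trunc]
    · obtain rfl : k = 0 := by omega
      simp [adjVec_last, charpoly]
  | succ N ih =>
    obtain ⟨z, hz, hz0, hzP, hzs⟩ := ih
    have hroot : ∀ k < N + 1, (trunc (N + 1) T).charpoly.eval (z k) = 0 := by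
      intro k hk
      rw [hzP, eval_prod]
      exact Finset.prod_eq_zero (Finset.mem_range.2 hk) (by simp)
    have hne : ∀ k < N + 1, (trunc N T).charpoly.eval (z k) ≠ 0 :=
      fun k hk => right_ne_zero_of_mul (hzs k hk).1.ne'
    have hsturm : ∀ k < N + 1, 0 < (-1) ^ (k + 1) * (trunc (N + 2) T).charpoly.eval (z k) := by
      intro k hk
      have h1 := (hzs k hk).1
      have h2 := (h.sturm hp hq (hz0 k hk) (hroot k hk) (hne k hk)).2
      have h3 : ((-1 : ℝ) ^ k) ^ 2 = 1 := by rw [← pow_mul, mul_comm, pow_mul]; simp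
      have h4 : 0 < ((-1) ^ k * (trunc N T).charpoly.eval (z k)) *
          ((-1) ^ (k + 1) * (trunc (N + 2) T).charpoly.eval (z k)) := by
        rw [pow_succ]
        calc _ < -((trunc N T).charpoly.eval (z k) * (trunc (N + 2) T).charpoly.eval (z k)) := by
                linarith
          _ = _ := by linear_combination ((trunc N T).charpoly.eval (z k) *
                (trunc (N + 2) T).charpoly.eval (z k)) * h3
      exact pos_of_mul_pos_right h4 h1.le
    obtain ⟨b, hb, hbP⟩ := exists_eval_pos (charpoly_monic (trunc (N + 2) T))
      (by rw [natDegree_charpoly_trunc]; omega) (z 0)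
    -- The mesh `b > z 0 > ⋯ > z N > 0`, on which the next characteristic polynomial alternates in
    -- sign; the default value `0` supplies the last point `e (N + 2)`.
    set e : ℕ → ℝ := fun k => Nat.casesOn k b fun k => if k < N + 1 then z k else 0 with he
    have he1 : ∀ k < N + 1, e (k + 1) = z k := fun k hk => if_pos hk
    have he2 : e (N + 2) = 0 := if_neg (lt_irrefl _)
    have hedec : ∀ k < N + 2, e (k + 1) < e k := by
      intro k hk
      rcases k with _ | k
      · rw [he1 0 (by omega)]
        exact hb
      · rw [he1 k (by omega)]
        rcases Nat.lt_or_ge (k + 1) (N + 1) with hk' | hk'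
        · rw [he1 (k + 1) hk']
          exact hz k hk'
        · obtain rfl : k = N := by omega
          rw [he2]
          exact hz0 k (by omega)
    have hesign : ∀ k ≤ N + 2, 0 < (-1) ^ k * (trunc (N + 2) T).charpoly.eval (e k) := by
      intro k hk
      rcases k with _ | k
      · rw [pow_zero, one_mul]
        exact hbP
      · rcases Nat.lt_or_ge k (N + 1) with hk' | hk'
        · rw [he1 k hk']
          exact hsturm k hk'
        · obtain rfl : k = N + 1 := by omega
          rw [he2, det_eq_eval_charpoly]
          exact h.det_pos _
    obtain ⟨r, hr, hrP⟩ := exists_interlacing_roots (charpoly_monic (trunc (N + 2) T))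
      (natDegree_charpoly_trunc T (N + 2)) hedec hesign
    have hrz : ∀ k < N + 1, z k < r k ∧ r (k + 1) < z k := by
      intro k hk
      rw [← he1 k hk]
      exact ⟨(hr k (by omega)).1, (hr (k + 1) (by omega)).2⟩
    have hrdec : ∀ k, k + 1 < N + 2 → r (k + 1) < r k :=
      fun k hk => (hrz k (by omega)).2.trans (hrz k (by omega)).1
    have hr0 : ∀ k < N + 2, 0 < r k := by
      intro k hk
      rcases Nat.lt_or_ge k (N + 1) with hk' | hk'
      · exact (hz0 k hk').trans (hrz k hk').1
      · obtain rfl : k = N + 1 := by omega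
        have := (hr (N + 1) (by omega)).1
        rwa [he2] at this
    have hsmall : ∀ k < N + 2, ∀ x, e (k + 1) < x → x ≤ r k →
        0 < (-1) ^ k * (trunc (N + 1) T).charpoly.eval x := by
      intro k hk x hx1 hx2
      rw [hzP]
      refine neg_one_pow_mul_eval_prod_pos (by omega) (fun j hj => ?_) fun j hj hjN => ?_
      · have := antitone_of_succ_lt hrdec (Nat.succ_le_of_lt hj) hk
        have := (hrz j (by omega)).2
        linarith
      · rw [he1 k (by omega)] at hx1
        linarith [antitone_of_succ_lt hz hj hjN]
    refine ⟨r, hrdec, hr0, hrP, fun k hk => ⟨hsmall k hk _ (hr k hk).1 le_rfl, ?_⟩⟩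
    have helo : 0 ≤ e (k + 1) ∧ 0 < adjVec T (N + 1) (e (k + 1)) 0 := by
      rcases Nat.lt_or_ge k (N + 1) with hk' | hk'
      · rw [he1 k hk']
        exact ⟨(hz0 k hk').le, h.adjVec_root_pos hp hq (hz0 k hk') (hroot k hk') (hne k hk')
          (hzs k hk').2⟩
      · obtain rfl : k = N + 1 := by omega
        rw [he2]
        exact ⟨le_rfl, h.adjVec_zero_pos hq _⟩
    -- Otherwise the first entry, positive at `e (k + 1)`, would vanish in `(e (k + 1), r k]`, where
    -- the two characteristic polynomials have the signs that exclude this.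
    by_contra hneg
    have hc : ContinuousOn (fun x => adjVec T (N + 1) x 0) (Set.Icc (e (k + 1)) (r k)) := by
      unfold adjVec
      fun_prop
    obtain ⟨x, ⟨hx1, hx2⟩, hx⟩ := intermediate_value_Icc' (hr k hk).1.le hc
      (show (0 : ℝ) ∈ Set.Icc _ _ from ⟨not_lt.1 hneg, helo.2.le⟩)
    have hx1' : e (k + 1) < x := by
      refine lt_of_le_of_ne hx1 ?_
      rintro rfl
      exact helo.2.ne' hx
    refine h.adjVec_ne_zero hq (helo.1.trans_lt hx1') (hsmall k hk x hx1' hx2) ?_ hx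
    rw [hrP]
    refine neg_one_pow_mul_eval_prod_nonneg (by omega) (fun j hj => ?_) fun j hj hjN => ?_
    · exact hx2.trans (antitone_of_succ_lt hrdec (Nat.lt_succ_iff.1 hj) hk)
    · have h1 := antitone_of_succ_lt hrdec hj hjN
      have h2 := (hrz k (by omega)).2
      rw [he1 k (by omega)] at hx1'
      linarith

end

/-! ### Determinantal polynomials as adjugate entries, and positivity of `ρ`. -/

theorem detPoly_eq_sum {r : ℕ} (hr : 1 ≤ r) (F : Fin r → ℕ → ℝ[X]) (n N : ℕ) :
    detPoly F n N = ∑ c, F c n * ((-1) ^ (c : ℕ) * minorPoly F c N) := by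
  obtain ⟨r, rfl⟩ : ∃ r', r = r' + 1 := ⟨r - 1, by omega⟩
  rw [detPoly, det_succ_row_zero]
  refine Finset.sum_congr rfl fun c _ => ?_
  have h : (of fun i c : Fin (r + 1) => F c (if (i : ℕ) = 0 then n else N + i)).submatrix Fin.succ
      c.succAbove = of fun i j : Fin (r + 1 - 1) => F (skip c j) (N + 1 + i) := by
    ext1 i j
    have hs : skip c j = c.succAbove j := by
      ext
      simp only [skip, Fin.succAbove, Fin.lt_def, Fin.val_castSucc]
      split_ifs <;> rfl
    simp [hs, add_assoc, add_comm 1]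
  rw [h, minorPoly]
  simp only [of_apply, Fin.val_zero, if_true]
  ring

theorem detPoly_eq_zero {r : ℕ} (F : Fin r → ℕ → ℝ[X]) {n N : ℕ} (h1 : N < n) (h2 : n < N + r) :
    detPoly F n N = 0 := by
  refine det_zero_of_row_eq (i := ⟨0, by omega⟩) (j := ⟨n - N, by omega⟩)
    (by simp only [ne_eq, Fin.mk.injEq]; omega) ?_
  funext c
  simp only [of_apply, if_true]
  rw [if_neg (by omega), show N + (n - N) = n by omega]

/-- Both determinants have the rows `N + 1, …, N + r`, up to a cyclic rotation. This is the origin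
of the sign in `betaCoeff`. -/
theorem detPoly_shift {r : ℕ} (hr : 1 ≤ r) (F : Fin r → ℕ → ℝ[X]) (N : ℕ) :
    detPoly F (N + 1) (N + 1) = (-1) ^ (r - 1) * detPoly F (N + r) N := by
  obtain ⟨r, rfl⟩ : ∃ r', r = r' + 1 := ⟨r - 1, by omega⟩
  have h := det_permute (finRotate (r + 1))
    (of fun i c : Fin (r + 1) => F c (if (i : ℕ) = 0 then N + (r + 1) else N + i))
  rw [sign_finRotate] at h
  simp only [Units.val_pow_eq_pow_val, Units.val_neg, Units.val_one, Int.cast_pow, Int.cast_neg,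
    Int.cast_one] at h
  rw [detPoly, detPoly, ← h]
  congr 1
  ext1 i c
  simp only [of_apply, submatrix_apply, id_eq]
  congr 1
  rcases Fin.eq_castSucc_or_eq_last i with ⟨j, rfl⟩ | rfl
  · rw [finRotate_of_lt (by simp)]
    simp only [Fin.val_castSucc, Nat.succ_ne_zero, if_false]
    split_ifs <;> omega
  · rw [finRotate_last]
    simp only [Fin.val_last, Fin.val_zero, if_true]
    split_ifs <;> omega

theorem IsLowerUnitriangular.det_eq_one {r : ℕ} {M : Matrix (Fin r) (Fin r) ℝ}
    (h : IsLowerUnitriangular M) : M.det = 1 := by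
  rw [det_of_isLowerTriangular M fun i j hij => h.2 i j hij]
  simp [h.1]

/-- Nonzero outermost superdiagonal, and zeros above it. -/
def IsUpperBanded (q : ℕ) (T : Matrix ℕ ℕ ℝ) : Prop :=
  ∀ n, (∀ i, n + q < i → T n i = 0) ∧ T n (n + q) ≠ 0

theorem IsPBF.isUpperBanded {p q : ℕ} {T : Matrix ℕ ℕ ℝ} {L : ℕ → ℕ → ℝ} {Δ : ℕ → ℝ}
    {U : ℕ → ℕ → ℝ} (h : IsPBF p q T L Δ U) : IsUpperBanded q T :=
  fun n => ⟨(h.transpose.band n).1, (h.transpose.band n).2.ne'⟩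

theorem IsUpperBanded.betaCoeff_ne_zero {q : ℕ} {T : Matrix ℕ ℕ ℝ} (hT : IsUpperBanded q T)
    (N : ℕ) : betaCoeff T q N ≠ 0 :=
  mul_ne_zero (by simp) (Finset.prod_ne_zero_iff.2 fun j _ => (hT j).2)

theorem betaCoeff_succ (T : Matrix ℕ ℕ ℝ) (q N : ℕ) :
    betaCoeff T q (N + 1) = betaCoeff T q N * T N (N + q) * (-1) ^ (q - 1) := by
  rw [betaCoeff, betaCoeff, Finset.prod_range_succ, Nat.mul_succ, pow_add]
  ring

section
variable {q : ℕ} {T : Matrix ℕ ℕ ℝ} {ξ : Matrix (Fin q) (Fin q) ℝ}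

theorem sum_mul_detPoly (hT : IsUpperBanded q T) (hq : 1 ≤ q) (n N : ℕ) :
    ∑ m ∈ Finset.range (n + q + 1), C (T n m) * detPoly (rightPoly T q ξ) m N =
      X * detPoly (rightPoly T q ξ) n N := by
  simp only [detPoly_eq_sum hq, Finset.mul_sum]
  rw [Finset.sum_comm]
  refine Finset.sum_congr rfl fun c _ => ?_
  have h := leftPoly_rec Tᵀ q hq ξ c n (hT n).2
  change ∑ m ∈ Finset.range (n + q + 1), rightPoly T q ξ c m * C (T n m) =
    X * rightPoly T q ξ c n at h
  rw [← mul_assoc, ← h, Finset.sum_mul]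
  exact Finset.sum_congr rfl fun m _ => by ring

/-- Indices strictly between `N` and `N + q` give determinants with a repeated row. Only index `N +
q` survives beyond `N`, and the band reaches it from row `N` alone. -/
theorem sum_mul_detPoly_trunc (hT : IsUpperBanded q T) (hq : 1 ≤ q) {i N : ℕ} (hi : i ≤ N) :
    ∑ m ∈ Finset.range (N + 1), C (T i m) * detPoly (rightPoly T q ξ) m N =
      X * detPoly (rightPoly T q ξ) i N -
        if i = N then C (T N (N + q)) * detPoly (rightPoly T q ξ) (N + q) N else 0 := by
  have h1 : ∑ m ∈ Finset.range (N + q + 1), C (T i m) * detPoly (rightPoly T q ξ) m N =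
      X * detPoly (rightPoly T q ξ) i N := by
    rw [← sum_mul_detPoly hT hq]
    refine (Finset.sum_subset (Finset.range_mono (by omega)) fun m _ hm => ?_).symm
    rw [Finset.mem_range, not_lt] at hm
    rw [(hT i).1 m (by omega), C_0, zero_mul]
  have h2 : ∑ m ∈ Finset.range (N + 1), C (T i m) * detPoly (rightPoly T q ξ) m N =
      ∑ m ∈ Finset.range (N + q), C (T i m) * detPoly (rightPoly T q ξ) m N := by
    refine Finset.sum_subset (Finset.range_mono (by omega)) fun m hm hm' => ?_
    rw [Finset.mem_range] at hm hm'
    rw [detPoly_eq_zero _ (by omega) hm, mul_zero]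
  rw [h2, ← h1, Finset.sum_range_succ]
  split_ifs with h
  · rw [h]
    ring
  · rw [(hT i).1 (N + q) (by omega)]
    simp

/-- The scaled determinants solve the linear system of `adjCol` with `g` in place of the
characteristic polynomial on the right. They are therefore proportional to `adjCol`, and the known
entry `N` fixes the ratio. -/
theorem C_betaCoeff_mul_detPoly_step (hT : IsUpperBanded q T) (hq : 1 ≤ q) {N : ℕ}
    (hN : C (betaCoeff T q N) * detPoly (rightPoly T q ξ) N N = (trunc N T).charpoly) :
    C (betaCoeff T q (N + 1)) * detPoly (rightPoly T q ξ) (N + 1) (N + 1) =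
        (trunc (N + 1) T).charpoly ∧
      ∀ n ≤ N, C (betaCoeff T q N) * detPoly (rightPoly T q ξ) n N = adjCol T N n := by
  set w : ℕ → ℝ[X] := fun n => C (betaCoeff T q N) * detPoly (rightPoly T q ξ) n N with hw
  set g := C (betaCoeff T q (N + 1)) * detPoly (rightPoly T q ξ) (N + 1) (N + 1) with hg
  have hg' : g = C (betaCoeff T q N) *
      (C (T N (N + q)) * detPoly (rightPoly T q ξ) (N + q) N) := by
    rw [hg, betaCoeff_succ, detPoly_shift hq]
    simp only [C_mul, C_pow, C_neg, C_1]
    have : ((-1 : ℝ[X]) ^ (q - 1)) ^ 2 = 1 := by rw [← pow_mul, mul_comm, pow_mul]; simp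
    linear_combination C (betaCoeff T q N) * C (T N (N + q)) *
      detPoly (rightPoly T q ξ) (N + q) N * this
  have h1 : charmatrix (trunc (N + 1) T) *ᵥ (fun j : Fin (N + 1) => w j) =
      g • Pi.single (Fin.last N) 1 := by
    funext i
    have h := sum_mul_detPoly_trunc (ξ := ξ) hT hq (Nat.lt_succ_iff.1 i.2)
    have h' : ∑ j ∈ Finset.range (N + 1), C (T i j) * w j = C (betaCoeff T q N) *
        ∑ m ∈ Finset.range (N + 1), C (T i m) * detPoly (rightPoly T q ξ) m N := by
      rw [Finset.mul_sum]
      exact Finset.sum_congr rfl fun m _ => by simp only [hw]; ring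
    rw [charmatrix_mulVec, h', h, Pi.smul_apply, Pi.single_apply, hg']
    simp only [hw, Fin.ext_iff, Fin.val_last, smul_eq_mul]
    split_ifs <;> ring
  have h2 : ∀ n : Fin (N + 1), (trunc (N + 1) T).charpoly * w n = g * adjCol T N n := by
    intro n
    have := congrFun (eq_adjugate_mulVec h1) n
    rw [mulVec_single_one] at this
    rw [adjCol_fin]
    exact this
  have h3 : g = (trunc (N + 1) T).charpoly := by
    have h := h2 (Fin.last N)
    rw [Fin.val_last, adjCol_last] at h
    have hw' : w N = (trunc N T).charpoly := hN
    rw [hw'] at h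
    exact (mul_right_cancel₀ (charpoly_monic _).ne_zero h).symm
  refine ⟨h3, fun n hn => ?_⟩
  have h := h2 ⟨n, by omega⟩
  rw [h3] at h
  exact mul_left_cancel₀ (charpoly_monic _).ne_zero h

theorem C_betaCoeff_mul_detPoly_self (hT : IsUpperBanded q T) (hq : 1 ≤ q)
    (hξ : IsLowerUnitriangular ξ) (N : ℕ) :
    C (betaCoeff T q N) * detPoly (rightPoly T q ξ) N N = (trunc N T).charpoly := by
  induction N with
  | zero =>
    have h : (of fun i c : Fin q => rightPoly T q ξ c (if (i : ℕ) = 0 then 0 else 0 + i)) =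
        (C : ℝ →+* ℝ[X]).mapMatrix ξ := by
      ext1 i c
      have : (if (i : ℕ) = 0 then 0 else 0 + (i : ℕ)) = i := by split_ifs <;> omega
      rw [of_apply, this, rightPoly, leftPoly_init]
      rfl
    rw [detPoly, h, ← RingHom.map_det, hξ.det_eq_one]
    simp [betaCoeff, charpoly]
  | succ N ih => exact (C_betaCoeff_mul_detPoly_step hT hq ih).1

/-- The range includes every initial index `n < q`, even with `N < n`, where both sides vanish. -/
theorem C_betaCoeff_mul_detPoly (hT : IsUpperBanded q T) (hq : 1 ≤ q)
    (hξ : IsLowerUnitriangular ξ) {n N : ℕ} (hn : n < N + q) :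
    C (betaCoeff T q N) * detPoly (rightPoly T q ξ) n N = adjCol T N n := by
  rcases Nat.lt_or_ge N n with h | h
  · rw [detPoly_eq_zero _ h hn, mul_zero, adjCol_supp T N h]
  · exact (C_betaCoeff_mul_detPoly_step hT hq (C_betaCoeff_mul_detPoly_self hT hq hξ N)).2 n h

/-- For `n < q` the first row of the determinant is row `n` of `ξ`, and its cofactors, scaled by
`β_N`, are the Christoffel numbers. -/
theorem mulVec_christoffelRho (hT : IsUpperBanded q T) (hq : 1 ≤ q)
    (hξ : IsLowerUnitriangular ξ) (N : ℕ) (x : ℝ) :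
    ξ *ᵥ (christoffelRho T q ξ N x) = fun n : Fin q => adjVec T N x n := by
  funext n
  have h := congrArg (eval x) (C_betaCoeff_mul_detPoly hT hq hξ (n := n) (N := N) (by omega))
  rw [detPoly_eq_sum hq] at h
  simp only [eval_mul, eval_C, eval_finsetSum, eval_pow, eval_neg, eval_one, rightPoly,
    leftPoly_init] at h
  rw [adjVec, ← h, mulVec, dotProduct, Finset.mul_sum]
  refine Finset.sum_congr rfl fun c _ => ?_
  simp only [christoffelRho]
  ring

end

theorem IsPBF.christoffelRho_pos {p q : ℕ} {T : Matrix ℕ ℕ ℝ} {L : ℕ → ℕ → ℝ} {Δ : ℕ → ℝ}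
    {U : ℕ → ℕ → ℝ} (h : IsPBF p q T L Δ U) (hq : 1 ≤ q) {ξ ℬ : Matrix (Fin q) (Fin q) ℝ}
    (hξ : IsLowerUnitriangular ξ) (hℬ1 : ∀ i, ℬ i i = 1) (hℬ0 : ∀ i j, 0 ≤ ℬ i j)
    (hξℬ : ξ⁻¹ = ℬ * upsilonMat q U) {N : ℕ} {x : ℝ} (hx : 0 < x)
    (hroot : (trunc (N + 1) T).charpoly.eval x = 0) (h0 : 0 < adjVec T N x 0) (b : Fin q) :
    0 < christoffelRho T q ξ N x b := by
  have hρ : christoffelRho T q ξ N x =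
      ℬ *ᵥ (upsilonMat q U *ᵥ fun n : Fin q => adjVec T N x n) := by
    rw [mulVec_mulVec, ← hξℬ, ← mulVec_christoffelRho h.isUpperBanded hq hξ, mulVec_mulVec,
      nonsing_inv_mul _ (by rw [hξ.det_eq_one]; exact isUnit_one), one_mulVec]
  have hact : ∀ i < N + 1, act T (N + 1) (adjVec T N x) i = x * adjVec T N x i := by
    intro i hi
    rw [act_adjVec T (Nat.lt_succ_iff.1 hi), hroot, ite_self, sub_zero]
  have hpos : ∀ c, 0 < (upsilonMat q U *ᵥ fun n : Fin q => adjVec T N x n) c := by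
    intro c
    rw [upsilonMat_mulVec]
    refine mul_pos (inv_pos.2 (Finset.prod_pos fun i hi => ?_)) ?_
    · rw [Finset.mem_range] at hi
      exact h.upper_pos _ (by omega) (by omega) _
    · exact h.upperIter_pos (Nat.succ_pos N) (adjVec_supp T N x) (eigen_sign hx hact) h0 c.2.le
  rw [hρ]
  refine Finset.sum_pos' (fun c _ => mul_nonneg (hℬ0 b c) (hpos c).le) ⟨b, Finset.mem_univ _, ?_⟩
  rw [hℬ1, one_mul]
  exact hpos b

/-! ### The denominator of `μ`. -/

/-- Differentiate the identity between `X - M` times its adjugate and the scalar matrix of the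
characteristic polynomial, then multiply by the adjugate. At an eigenvalue the second term drops
out. -/
theorem derivative_charmatrix_adjugate {n : ℕ} (M : Matrix (Fin n) (Fin n) ℝ) :
    (charmatrix M).adjugate * (charmatrix M).adjugate +
      M.charpoly • (charmatrix M).adjugate.map derivative =
      derivative M.charpoly • (charmatrix M).adjugate := by
  have h : (charmatrix M).adjugate + charmatrix M * (charmatrix M).adjugate.map derivative =
      derivative M.charpoly • (1 : Matrix (Fin n) (Fin n) ℝ[X]) := by
    ext1 i j
    have h1 := congrArg derivative (congrFun (congrFun (mul_adjugate (charmatrix M)) i) j)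
    rw [Matrix.mul_apply, derivative_sum] at h1
    simp only [derivative_mul, Finset.sum_add_distrib] at h1
    have h2 : ∀ k, derivative (charmatrix M i k) = (1 : Matrix (Fin n) (Fin n) ℝ[X]) i k := by
      intro k
      by_cases hik : i = k
      · subst hik
        simp
      · simp [hik]
    simp only [h2] at h1
    have h3 : ∑ k, (1 : Matrix (Fin n) (Fin n) ℝ[X]) i k * (charmatrix M).adjugate k j =
        (charmatrix M).adjugate i j := by
      rw [← Matrix.mul_apply, one_mul]
    rw [h3] at h1
    rw [Matrix.add_apply, Matrix.mul_apply]
    simp only [Matrix.map_apply]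
    rw [h1, charpoly]
    by_cases hij : i = j
    · subst hij
      simp
    · simp [hij]
  have h' := congrArg ((charmatrix M).adjugate * ·) h
  simp only [Matrix.mul_add, ← Matrix.mul_assoc, adjugate_mul, Matrix.mul_smul, Matrix.mul_one,
    Matrix.smul_mul, Matrix.one_mul] at h'
  exact h'

/-- The product of the last row and the last column of the adjugate at an eigenvalue. -/
theorem sum_adjVec_mul_adjVec (T : Matrix ℕ ℕ ℝ) {N : ℕ} {x : ℝ}
    (hx : (trunc (N + 1) T).charpoly.eval x = 0) :
    ∑ l ∈ Finset.range (N + 1), adjVec Tᵀ N x l * adjVec T N x l =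
      (derivative (trunc (N + 1) T).charpoly).eval x * (trunc N T).charpoly.eval x := by
  have h := congrFun (congrFun (derivative_charmatrix_adjugate (trunc (N + 1) T)) (Fin.last N))
    (Fin.last N)
  rw [Matrix.add_apply, Matrix.mul_apply, Matrix.smul_apply, Matrix.smul_apply, smul_eq_mul,
    smul_eq_mul, ← adjCol_fin, Fin.val_last, adjCol_last] at h
  simp only [← adjCol_fin, ← adjCol_transpose_fin] at h
  have h := congrArg (eval x) h
  simp only [eval_add, eval_mul, hx, zero_mul, add_zero, eval_finsetSum] at h
  rw [← h, Finset.sum_range]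
  rfl

theorem neg_one_pow_mul_eval_derivative_prod_pos {n k : ℕ} (hk : k < n) {r : ℕ → ℝ}
    (hr : ∀ j, j + 1 < n → r (j + 1) < r j) :
    0 < (-1) ^ k * (derivative (∏ j ∈ Finset.range n, (X - C (r j)))).eval (r k) := by
  have h : ∏ j ∈ Finset.range n, (X - C (r j)) =
      (X - C (r k)) * ((∏ j ∈ Finset.range k, (X - C (r j))) *
        ∏ j ∈ Finset.Ico (k + 1) n, (X - C (r j))) := by
    rw [← Finset.prod_range_mul_prod_Ico _ (Nat.succ_le_of_lt hk), Finset.prod_range_succ]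
    ring
  rw [h, derivative_mul]
  simp only [derivative_sub, derivative_X, derivative_C, sub_zero, one_mul, eval_add, eval_mul,
    eval_sub, eval_X, eval_C, sub_self, zero_mul, add_zero]
  rw [← mul_assoc]
  refine mul_pos ?_ ?_
  · have := neg_one_pow_mul_eval_prod_pos (n := k) le_rfl (r := r) (x := r k) (fun j hj =>
      (antitone_of_succ_lt hr (Nat.succ_le_of_lt hj) hk).trans_lt (hr j (by omega)))
      (fun j h1 h2 => by omega)
    exact this
  · rw [eval_prod]
    refine Finset.prod_pos fun j hj => ?_
    rw [Finset.mem_Ico] at hj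
    rw [eval_sub, eval_X, eval_C, sub_pos]
    exact (antitone_of_succ_lt hr hj.1 hj.2).trans_lt (hr k (by omega))

end MixedBanded

end

/-! ### Assembly of the theorem. -/

theorem mainTheorem3 (p q : ℕ) (hp : 1 ≤ p) (hq : 1 ≤ q)
    (T : Matrix ℕ ℕ ℝ) (L : ℕ → ℕ → ℝ) (Δ : ℕ → ℝ) (U : ℕ → ℕ → ℝ)
    (hT : MixedBanded.IsPBF p q T L Δ U)
    (ν 𝒜 : Matrix (Fin p) (Fin p) ℝ) (ξ ℬ : Matrix (Fin q) (Fin q) ℝ)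
    (hν : MixedBanded.IsLowerUnitriangular ν) (hξ : MixedBanded.IsLowerUnitriangular ξ)
    (h𝒜 : MixedBanded.IsUpperUnitriangular 𝒜) (h𝒜0 : ∀ i j, 0 ≤ 𝒜 i j)
    (hℬ : MixedBanded.IsLowerUnitriangular ℬ) (hℬ0 : ∀ i j, 0 ≤ ℬ i j)
    (hν𝒜 : (νᵀ)⁻¹ = MixedBanded.lambdaMat p L * 𝒜)
    (hξℬ : ξ⁻¹ = ℬ * MixedBanded.upsilonMat q U) (N : ℕ) :
    ∃ lam : Fin (N + 1) → ℝ, StrictAnti lam ∧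
      (MixedBanded.trunc (N + 1) T).charpoly = ∏ k, (X - C (lam k)) ∧
      ∀ k, (∀ b, 0 < MixedBanded.christoffelRho T q ξ N (lam k) b) ∧
        (∀ a, 0 < MixedBanded.christoffelMu T p q ν ξ N (lam k) a) := by
  obtain ⟨r, hr, hr0, hrP, hrs⟩ := hT.spectrum hp hq N
  obtain ⟨r', -, -, hrP', hrs'⟩ := hT.transpose.spectrum hq hp N
  rw [MixedBanded.charpoly_trunc_transpose] at hrP'
  refine ⟨fun k => r k, fun i j hij => ?_, ?_, fun k => ?_⟩
  · exact (MixedBanded.antitone_of_succ_lt hr (Nat.succ_le_of_lt hij) j.2).trans_lt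
      (hr i (by have : (i : ℕ) < j := hij; omega))
  · rw [hrP, Finset.prod_range]
  have hroot : (MixedBanded.trunc (N + 1) T).charpoly.eval (r k) = 0 := by
    rw [hrP, eval_prod]
    exact Finset.prod_eq_zero (Finset.mem_range.2 k.2) (by simp)
  -- The spectrum of `Tᵀ` comes with its own enumeration; equality of characteristic polynomials
  -- makes `r k` one of its members.
  have h0' : 0 < MixedBanded.adjVec Tᵀ N (r k) 0 := by
    have h := hroot
    rw [hrP', eval_prod, Finset.prod_eq_zero_iff] at h
    obtain ⟨j, hj, h⟩ := h
    rw [eval_sub, eval_X, eval_C, sub_eq_zero] at h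
    rw [h]
    exact (hrs' j (Finset.mem_range.1 hj)).2
  refine ⟨hT.christoffelRho_pos hq hξ hℬ.1 hℬ0 hξℬ (hr0 k k.2) hroot (hrs k k.2).2, fun a => ?_⟩
  -- Transposed, the condition on `ν` is the condition on `ξ` for the matrix `Tᵀ`.
  have hν' : ν⁻¹ = 𝒜ᵀ * MixedBanded.upsilonMat p L := by
    have h := congrArg transpose hν𝒜
    rwa [transpose_nonsing_inv, transpose_transpose, transpose_mul, MixedBanded.lambdaMat_eq,
      transpose_transpose] at h
  have hnum := hT.transpose.christoffelRho_pos hp hν (ℬ := 𝒜ᵀ) h𝒜.1 (fun i j => h𝒜0 j i) hν'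
    (hr0 k k.2) (by rwa [MixedBanded.charpoly_trunc_transpose]) h0' a
  -- With both factors `β`, the sum pairs the last row and last column of the adjugate, and equals
  -- `P_{N+1}' P_N` at `r k`; both factors have the sign `(-1)^k`.
  have hden : 0 < MixedBanded.betaCoeff Tᵀ p N * (MixedBanded.betaCoeff T q N *
      ∑ l ∈ Finset.range (N + 1), (MixedBanded.detPoly (MixedBanded.leftPoly T p ν) l N).eval (r k) *
        (MixedBanded.detPoly (MixedBanded.rightPoly T q ξ) l N).eval (r k)) := by
    have h1 := mul_pos (MixedBanded.neg_one_pow_mul_eval_derivative_prod_pos k.2 hr)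
      (hrs k k.2).1
    have h2 : ((-1 : ℝ) ^ (k : ℕ)) ^ 2 = 1 := by rw [← pow_mul, mul_comm, pow_mul]; simp
    rw [← hrP, mul_mul_mul_comm, ← pow_two, h2, one_mul,
      ← MixedBanded.sum_adjVec_mul_adjVec T hroot] at h1
    refine h1.trans_eq ?_
    rw [Finset.mul_sum, Finset.mul_sum]
    refine Finset.sum_congr rfl fun l hl => ?_
    rw [Finset.mem_range] at hl
    rw [MixedBanded.adjVec, MixedBanded.adjVec,
      ← MixedBanded.C_betaCoeff_mul_detPoly hT.isUpperBanded hq hξ (by omega),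
      ← MixedBanded.C_betaCoeff_mul_detPoly hT.transpose.isUpperBanded hp hν (by omega),
      eval_mul, eval_mul, eval_C, eval_C]
    change _ * (MixedBanded.detPoly (MixedBanded.leftPoly T p ν) l N).eval (r k) * _ = _
    ring
  have hα := hT.transpose.isUpperBanded.betaCoeff_ne_zero N
  -- Multiplying numerator and denominator by the nonzero `β` of `Tᵀ` turns the numerator into the
  -- number `ρ` of `Tᵀ`.
  rw [MixedBanded.christoffelMu, ← mul_div_mul_left _ _ hα]
  refine div_pos ?_ hden
  refine hnum.trans_eq ?_
  rw [MixedBanded.christoffelRho]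
  change _ * (MixedBanded.minorPoly (MixedBanded.leftPoly T p ν) a N).eval (r k) = _
  ring
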